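/- Consider the M/M/1 retrial queue with arrival rate $\lambda>0$, service rate $\mu>0$, retrial rate $\theta>0$ per customer in the orbit, and $\rho=\lambda/\mu<1$. Let $C(t)\in\{W,I\}$ be the state of the server (busy, idle) and $N(t)\in\{0,1,2,\dots\}$ the number of customers in the orbit: $(C(t),N(t))_{t\ge 0}$ is the continuous-time Markov chain, with an arbitrary initial law, whose transitions are $(W,k)\to(W,k+1)$ at rate $\lambda$, $(W,k)\to(I,k)$ at rate $\mu$, $(I,k)\to(W,k)$ at rate $\lambda$, and $(I,k)\to(W,k-1)$ at rate $k\theta$ for $k\ge1$. Then the limits $x_{c,k}=\lim_{t\to\infty}P\{C(t)=c,N(t)=k\}$ exist for $c\in\{W,I\}$, $k\ge 0$, and form a probability vector. Put $\pi_{c,k}=\sum_{j\ge k}x_{c,j}$ and $\Pi_k=(\pi_{W,k},\pi_{I,k})$. Then $\Pi_0=(\rho,1-\rho)$, and $\Pi=(\Pi_1,\Pi_2,\dots)$ satisfies $$\Pi Q=(-\lambda\rho,0,0,\dots),$$ with all the series involved convergent, where $Q$ is the infinite matrix of $2\times2$ blocks $Q_{k,k+1}=C$, $Q_{k,k}=A_k$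 $(k\ge1)$, $Q_{k,k-1}=B_k$ $(k\ge2)$, $Q_{k,j}=D$ $(1\le j\le k-2)$, $Q_{k,j}=0$ $(j\ge k+2)$, with $$A_k=\begin{pmatrix}-(\lambda+\mu)&\mu\\ \lambda&-(\lambda+k\theta)\end{pmatrix},\quad B_k=\begin{pmatrix}0&0\\ k\theta&-\theta\end{pmatrix},\quad C=\begin{pmatrix}\lambda&0\\0&0\end{pmatrix},\quad D=\begin{pmatrix}0&0\\ \theta&-\theta\end{pmatrix}.$$ Moreover, the system $$C+R_kA_{k+1}+R_kR_{k+1}B_{k+2}+R_kR_{k+1}\Bigl(\sum_{l=2}^{\infty}R_{k+2}R_{k+3}\cdots R_{k+l}\Bigr)D=0,\qquad k\ge1,$$ has an (entrywise) minimal solution $\{R_k:k\ge1\}$ among the sequences of nonnegative $2\times 2$ matrices for which these series converge. For this solution (the $R$-measure), the series $\sum_{l\ge1}R_k\cdots R_{k+l-1}$ converges for every $k\ge1$, and the matrices $$\Psi_k=A_k+R_kB_{k+1}+R_k\Bigl(\sum_{l=1}^{\infty}R_{k+1}\cdots R_{k+l}\Bigr)D,\qquad k\ge1,$$ are invertible,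 with $R_k=C(-\Psi_{k+1})^{-1}$. With $$G_{i,i-1}=(-\Psi_i)^{-1}\Bigl[B_i+\Bigl(\sum_{l=1}^\infty R_i\cdots R_{i+l-1}\Bigr)D\Bigr],\qquad G_i=(-\Psi_i)^{-1}\Bigl(I+\sum_{l=1}^\infty R_i\cdots R_{i+l-1}\Bigr)D,$$ the UL-type $RG$-factorization $$Q=(I-R_U)\,U_D\,(I-G_L)$$ holds, where $U_D=\mathrm{diag}(\Psi_1,\Psi_2,\dots)$, $R_U$ has the blocks $R_k$ at the positions $(k,k+1)$, $k\ge1$, and zero blocks elsewhere, and $G_L$ has the blocks $G_{i,i-1}$ at the positions $(i,i-1)$, $i\ge2$, the blocks $G_i$ at the positions $(i,j)$, $1\le j\le i-2$, and zero blocks elsewhere. Finally, $$\Pi_1=(\lambda\rho,0)\,(-\Psi_1^{-1}),\qquad \Pi_k=(\lambda\rho,0)\,(-\Psi_1^{-1})\,R_1R_2\cdots R_{k-1}\quad(k\ge2).$$ -/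

import Mathlib

open MeasureTheory ProbabilityTheory Filter Topology
open scoped NNReal Matrix

noncomputable section

namespace RetrialQueue

/-- Server state `W` (busy). -/
abbrev busy : Fin 2 := 0

/-- Server state `I` (idle). -/
abbrev idle : Fin 2 := 1

/-- A state `(C, N)`: the server state and the number of customers in the orbit. -/
abbrev State : Type := Fin 2 × ℕ

/-- The `2 × 2` blocks; rows and columns are ordered as `(W, I)`. -/
abbrev Block : Type := Matrix (Fin 2) (Fin 2) ℝ

/-- The infinitesimal generator of `(C(t), N(t))`: arrivals at rate `lam` start a service
when the server is idle and join the orbit when it is busy, a service ends at rate `mu`, and each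
of the `k` customers in the orbit retries at rate `theta`, successfully if the server is idle.
(For `k = 0` the retrial term has coefficient `0`.) -/
def generator (lam mu theta : ℝ) (f : State → ℝ) (s : State) : ℝ :=
  if s.1 = busy then
    lam * (f (busy, s.2 + 1) - f s) + mu * (f (idle, s.2) - f s)
  else
    lam * (f (busy, s.2) - f s) + (s.2 : ℝ) * theta * (f (busy, s.2 - 1) - f s)

/-- `X` is the Markov jump process `(C(t), N(t))` of the M/M/1 retrial queue, on a filtered
probability space and with an arbitrary initial law: an adapted right-continuous process that
solves the martingale problem of the generator (with finitely supported test functions). -/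
structure IsRetrialQueue {Ω : Type*} {mΩ : MeasurableSpace Ω} (lam mu theta : ℝ)
    (P : Measure Ω) (ℱ : Filtration ℝ≥0 mΩ) (X : ℝ≥0 → Ω → State) : Prop where
  adapted : ∀ t, Measurable[ℱ t] (X t)
  rightContinuous : ∀ ω t, ContinuousWithinAt (fun s => X s ω) (Set.Ici t) t
  martingale : ∀ f : State → ℝ, (Function.support f).Finite →
    Martingale (fun (t : ℝ≥0) (ω : Ω) =>
      f (X t ω) - ∫ s in (0 : ℝ)..(t : ℝ), generator lam mu theta f (X s.toNNReal ω)) ℱ P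

/-- The row vector `Π_k = (π_{W,k}, π_{I,k})`, `π_{c,k} = ∑_{j ≥ k} x_{c,j}`. -/
def tailPair (x : State → ℝ) (k : ℕ) : Fin 2 → ℝ := fun c => ∑' j : ℕ, x (c, k + j)

/-- The diagonal block `A_k`. -/
def blockA (lam mu theta : ℝ) (k : ℕ) : Block :=
  !![-(lam + mu), mu; lam, -(lam + k * theta)]

/-- The subdiagonal block `B_k` (`k ≥ 2`). -/
def blockB (theta : ℝ) (k : ℕ) : Block := !![0, 0; k * theta, -theta]

/-- The superdiagonal block `C`. -/
def blockC (lam : ℝ) : Block := !![lam, 0; 0, 0]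

/-- The block `D` below the subdiagonal. -/
def blockD (theta : ℝ) : Block := !![0, 0; theta, -theta]

/-- The infinite block matrix `Q`. The indices `i`, `j` stand for the levels `i + 1`, `j + 1`,
here and in all infinite block matrices below. -/
def Q (lam mu theta : ℝ) : Matrix ℕ ℕ Block := fun i j =>
  if j = i + 1 then blockC lam
  else if j = i then blockA lam mu theta (i + 1)
  else if j + 1 = i then blockB theta (i + 1)
  else if j + 1 < i then blockD theta
  else 0

/-- `R_k R_{k+1} ⋯ R_{k+l-1}` (`l` factors). -/
def prodR (R : ℕ → Block) (k : ℕ) : ℕ → Block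
  | 0 => 1
  | l + 1 => prodR R k l * R (k + l)

/-- `∑_{l ≥ 1} R_k R_{k+1} ⋯ R_{k+l-1}`. -/
def sumR (R : ℕ → Block) (k : ℕ) : Block := ∑' l : ℕ, prodR R k (l + 1)

/-- `(R_k)_{k ≥ 1}` is nonnegative, the series below converge, and for all `k ≥ 1`,
`C + R_k A_{k+1} + R_k R_{k+1} B_{k+2} + R_k R_{k+1} (∑_{l ≥ 2} R_{k+2} ⋯ R_{k+l}) D = 0`.
The value `R 0` plays no role. -/
def IsNonnegSolution (lam mu theta : ℝ) (R : ℕ → Block) : Prop :=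
  ∀ k : ℕ, 1 ≤ k →
    (∀ a b, 0 ≤ R k a b) ∧
    Summable (fun l : ℕ => prodR R (k + 2) (l + 1)) ∧
    blockC lam + R k * blockA lam mu theta (k + 1) + R k * R (k + 1) * blockB theta (k + 2)
      + R k * R (k + 1) * sumR R (k + 2) * blockD theta = 0

/-- The `R`-measure: the entrywise minimal nonnegative solution. -/
def IsRMeasure (lam mu theta : ℝ) (R : ℕ → Block) : Prop :=
  IsNonnegSolution lam mu theta R ∧
    ∀ S : ℕ → Block, IsNonnegSolution lam mu theta S →
      ∀ k : ℕ, 1 ≤ k → ∀ a b, R k a b ≤ S k a b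

/-- `Ψ_k = A_k + R_k B_{k+1} + R_k (∑_{l ≥ 1} R_{k+1} ⋯ R_{k+l}) D`. -/
def Psi (lam mu theta : ℝ) (R : ℕ → Block) (k : ℕ) : Block :=
  blockA lam mu theta k + R k * blockB theta (k + 1) + R k * sumR R (k + 1) * blockD theta

/-- `G_{i,i-1} = (-Ψ_i)⁻¹ (B_i + (∑_{l ≥ 1} R_i ⋯ R_{i+l-1}) D)`. -/
def Gsub (lam mu theta : ℝ) (R : ℕ → Block) (i : ℕ) : Block :=
  (-Psi lam mu theta R i)⁻¹ * (blockB theta i + sumR R i * blockD theta)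

/-- `G_i = G_{i,j} = (-Ψ_i)⁻¹ (I + ∑_{l ≥ 1} R_i ⋯ R_{i+l-1}) D` for `1 ≤ j ≤ i - 2`. -/
def Glow (lam mu theta : ℝ) (R : ℕ → Block) (i : ℕ) : Block :=
  (-Psi lam mu theta R i)⁻¹ * (1 + sumR R i) * blockD theta

/-- The strictly upper triangular factor `R_U`. -/
def factorRU (R : ℕ → Block) : Matrix ℕ ℕ Block := fun i j => if j = i + 1 then R (i + 1) else 0

/-- The block diagonal factor `U_D = diag(Ψ_1, Ψ_2, …)`. -/
def factorUD (lam mu theta : ℝ) (R : ℕ → Block) : Matrix ℕ ℕ Block :=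
  Matrix.diagonal fun i => Psi lam mu theta R (i + 1)

/-- The strictly lower triangular factor `G_L`. -/
def factorGL (lam mu theta : ℝ) (R : ℕ → Block) : Matrix ℕ ℕ Block := fun i j =>
  if j + 1 = i then Gsub lam mu theta R (i + 1)
  else if j + 1 < i then Glow lam mu theta R (i + 1)
  else 0

/-- The product of infinite block matrices. It is only used for products in which every row of the
left factor has finitely many nonzero blocks, so that all the sums are finite. -/
def blockMul (M N : Matrix ℕ ℕ Block) : Matrix ℕ ℕ Block := fun i j => ∑' l : ℕ, M i l * N l j

end RetrialQueue

end

/-!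
The balance equations of the idle states and the cut equations between orbit levels determine
the stationary law `x` explicitly. Summed over levels they give a recurrence for the tail vectors
`Π_k` that is at once the system for `Π Q` and, for the row vectors `v_l = u R_k ⋯ R_{k+l-1}` with
`u` arbitrary, the equation for the `R_k`. Conversely, the consecutive differences of a summable
solution `v` of this recurrence satisfy the cut and balance equations, hence are multiples of `x`.
Therefore `u R_k = (u_W / π_{W,k}) Π_{k+1}`: the solution `R_k = (1 / π_{W,k}, 0)ᵀ Π_{k+1}` is
unique, a fortiori minimal. It satisfies `Π_k R_k ⋯ R_{k+l-1} = Π_{k+l}` and `C + R_k Ψ_{k+1} = 0`,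
from which the factorization and the formulas for `Π_k` follow by block algebra.

For the convergence to `x`, start the queue in one state, so that the density `r` of its law
with respect to `x` is bounded at time `0`. The density evolves under the generator of the reversed
chain; truncated energies `∑ x φ(r)` with `φ` convex decrease up to a flux through the truncation
level. With `φ` vanishing on `(-∞, c]` this gives the bound `r ≤ c` for all times, and with
`φ(r) = r²` it makes the squared differences of `r` between neighbouring states integrable in time.
As `r` has bounded derivatives, these differences tend to `0`, hence `r` tends to a constant.
-/

namespace RetrialQueue

lemma hasSum_tsum_add_of_nonneg {b : ℕ → ℝ} (hb : ∀ n, 0 ≤ b n) {s : ℝ}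
    (h : HasSum (fun n : ℕ => ((n : ℝ) + 1) * b n) s) :
    HasSum (fun i => ∑' j, b (i + j)) s := by
  let f : ((n : ℕ) × Finset.HasAntidiagonal.antidiagonal n) → ℝ := fun p => b p.1
  have hfiber : ∀ n, HasSum (fun p => f ⟨n, p⟩) ((n + 1) * b n) := fun n => by
    simpa [f, Finset.Nat.card_antidiagonal] using
      hasSum_fintype fun p : Finset.HasAntidiagonal.antidiagonal n => f ⟨n, p⟩
  have hf : HasSum f s := h.sigma_of_hasSum hfiber <|
    (summable_sigma_of_nonneg fun p => hb p.1).2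
      ⟨fun n => (hfiber n).summable, h.summable.congr fun n => (hfiber n).tsum_eq.symm⟩
  have hprod : HasSum (fun p : ℕ × ℕ => b (p.1 + p.2)) s :=
    Finset.HasAntidiagonal.sigmaAntidiagonalEquivProd.symm.hasSum_iff.2 hf
  exact hprod.prod_fiberwise fun i => (hprod.summable.prod_factor i).hasSum

lemma frequently_natCast_mul_lt_of_summable {a : ℕ → ℝ} (ha : Summable a) {ε : ℝ} (hε : 0 < ε) :
    ∃ᶠ n : ℕ in atTop, n * a n < ε := by
  by_contra hev
  have hle : ∀ᶠ n : ℕ in atTop, ε * (n : ℝ)⁻¹ ≤ a n := by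
    filter_upwards [not_frequently.1 hev, eventually_gt_atTop 0] with n hn hn0
    have : (0 : ℝ) < n := mod_cast hn0
    rw [← div_eq_mul_inv, div_le_iff₀ this, mul_comm]
    exact not_lt.1 hn
  have hsum : Summable fun n : ℕ => ε * (n : ℝ)⁻¹ := by
    refine ha.of_norm_bounded_eventually_nat ?_
    filter_upwards [hle] with n hn
    rwa [Real.norm_of_nonneg (by positivity)]
  exact Real.not_summable_natCast_inv ((summable_mul_left_iff hε.ne').1 hsum)

lemma eq_of_succ_eq_of_tendsto {E : Type*} [TopologicalSpace E] [T2Space E] {u : ℕ → E} {a : E}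
    (h : ∀ n, u (n + 1) = u n) (hu : Tendsto u atTop (𝓝 a)) (n : ℕ) : u n = a := by
  have hconst : ∀ m, u m = u 0 := Nat.rec rfl fun m ih => (h m).trans ih
  have hlim : Tendsto u atTop (𝓝 (u 0)) := tendsto_const_nhds.congr fun m => (hconst m).symm
  rw [hconst, tendsto_nhds_unique hlim hu]

section VecMul

variable {R n : Type*} [CommSemiring R]

lemma vecMul_fin_two (v : Fin 2 → R) (M : Matrix (Fin 2) n R) (j : n) :
    (v ᵥ* M) j = v 0 * M 0 j + v 1 * M 1 j := by
  simp [Matrix.vecMul, dotProduct, Fin.sum_univ_two]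

variable [TopologicalSpace R] [IsTopologicalSemiring R] {ι m : Type*} [Fintype m]

lemma hasSum_vecMul_const {v : ι → m → R} {w : m → R} (h : HasSum v w) (M : Matrix m n R) :
    HasSum (fun i => v i ᵥ* M) (w ᵥ* M) :=
  h.map (Matrix.vecMulLinear M) (continuous_id.matrix_vecMul continuous_const)

lemma hasSum_const_vecMul {f : ι → Matrix m n R} {M : Matrix m n R} (h : HasSum f M) (v : m → R) :
    HasSum (fun i => v ᵥ* f i) (v ᵥ* M) :=
  h.map (Matrix.vecMulBilin R R v) (continuous_const.matrix_vecMul continuous_id)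

end VecMul

/-- `x` is a stationary distribution of the retrial queue, by the balance equations of the idle
states and the cut equations between consecutive orbit levels; it moreover has a finite mean orbit
size, which makes the tails `Π_k` summable. -/
structure IsStationary (lam mu theta : ℝ) (x : State → ℝ) : Prop where
  pos : ∀ s, 0 < x s
  hasSum : HasSum x 1
  balance : ∀ k : ℕ, mu * x (busy, k) = (lam + k * theta) * x (idle, k)
  cut : ∀ k : ℕ, ((k : ℝ) + 1) * theta * x (idle, k + 1) = lam * x (busy, k)
  summable_mul : ∀ c, Summable fun k : ℕ => (k : ℝ) * x (c, k)

/-- The stationary measure of the idle states, normalised to be `1` at the empty orbit. -/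
noncomputable def idleWeight (lam mu theta : ℝ) : ℕ → ℝ
  | 0 => 1
  | n + 1 => lam * (lam + n * theta) / (mu * ((n + 1) * theta)) * idleWeight lam mu theta n

/-- The stationary measure extending `idleWeight` to the busy states by the balance equations. -/
noncomputable def weight (lam mu theta : ℝ) (s : State) : ℝ :=
  if s.1 = busy then (lam + s.2 * theta) / mu * idleWeight lam mu theta s.2
  else idleWeight lam mu theta s.2

section Existence

variable {lam mu theta : ℝ}

@[simp] lemma weight_busy (k : ℕ) :
    weight lam mu theta (busy, k) = (lam + k * theta) / mu * idleWeight lam mu theta k := rfl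

@[simp] lemma weight_idle (k : ℕ) :
    weight lam mu theta (idle, k) = idleWeight lam mu theta k := rfl

lemma idleWeight_pos (hlam : 0 < lam) (hmu : 0 < mu) (htheta : 0 < theta) (n : ℕ) :
    0 < idleWeight lam mu theta n := by
  induction n with
  | zero => exact one_pos
  | succ n ih => rw [idleWeight]; positivity

lemma weight_pos (hlam : 0 < lam) (hmu : 0 < mu) (htheta : 0 < theta) (s : State) :
    0 < weight lam mu theta s := by
  have := idleWeight_pos hlam hmu htheta s.2
  unfold weight
  split_ifs <;> positivity

lemma summable_mul_mul_idleWeight (hlam : 0 < lam) (hmu : 0 < mu) (htheta : 0 < theta)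
    (hstable : lam / mu < 1) :
    Summable fun n : ℕ => (theta + n * theta) * (lam + n * theta) * idleWeight lam mu theta n := by
  have hpos := idleWeight_pos hlam hmu htheta
  refine summable_of_ratio_test_tendsto_lt_one hstable (.of_forall fun n => ?_) ?_
  · have := hpos n
    positivity
  · have hlim : Tendsto (fun n : ℕ => lam / mu * ((2 * theta + theta * n) / (theta + theta * n) *
        ((lam + theta + theta * n) / (theta + theta * n)))) atTop (𝓝 (lam / mu)) := by
      have h := fun a => tendsto_add_mul_div_add_mul_atTop_nhds a theta theta htheta.ne'
      simpa [htheta.ne'] using ((h (2 * theta)).mul (h (lam + theta))).const_mul (lam / mu)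
    refine hlim.congr fun n => ?_
    have := hpos n
    have := hpos (n + 1)
    rw [Real.norm_of_nonneg (by positivity), Real.norm_of_nonneg (by positivity), idleWeight]
    push_cast
    field_simp
    ring

lemma summable_succ_mul_weight (hlam : 0 < lam) (hmu : 0 < mu) (htheta : 0 < theta)
    (hstable : lam / mu < 1) (c : Fin 2) :
    Summable fun k : ℕ => ((k : ℝ) + 1) * weight lam mu theta (c, k) := by
  have hsum := summable_mul_mul_idleWeight hlam hmu htheta hstable
  have hpos := idleWeight_pos hlam hmu htheta
  have hbusy : Summable fun k : ℕ => ((k : ℝ) + 1) * weight lam mu theta (busy, k) := by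
    refine (hsum.mul_left (1 / (mu * theta))).congr fun k => ?_
    rw [weight_busy]
    field_simp
    ring
  have hidle : Summable fun k : ℕ => ((k : ℝ) + 1) * weight lam mu theta (idle, k) := by
    refine .of_nonneg_of_le (fun k => ?_) (fun k => ?_) (hbusy.mul_left (mu / lam))
    · exact mul_nonneg (by positivity) (hpos k).le
    · have := hpos k
      have hfactor : mu / lam * ((k + 1) * weight lam mu theta (busy, k)) =
          (k + 1) * idleWeight lam mu theta k * ((lam + k * theta) / lam) := by
        rw [weight_busy]
        field_simp
      rw [hfactor, weight_idle]
      refine le_mul_of_one_le_right (by positivity) ((one_le_div hlam).2 ?_)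
      exact le_add_of_nonneg_right (by positivity)
  exact Fin.cases hbusy (fun i => by rwa [Subsingleton.elim i 0]) c

lemma summable_weight (hlam : 0 < lam) (hmu : 0 < mu) (htheta : 0 < theta)
    (hstable : lam / mu < 1) : Summable (weight lam mu theta) := by
  have hpos := weight_pos hlam hmu htheta
  refine (summable_prod_of_nonneg fun s => (hpos s).le).2 ⟨fun c => ?_, .of_finite⟩
  refine .of_nonneg_of_le (fun k => (hpos _).le) (fun k => ?_)
    (summable_succ_mul_weight hlam hmu htheta hstable c)
  exact le_mul_of_one_le_left (hpos _).le (le_add_of_nonneg_left k.cast_nonneg)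

lemma exists_isStationary (hlam : 0 < lam) (hmu : 0 < mu) (htheta : 0 < theta)
    (hstable : lam / mu < 1) : ∃ x, IsStationary lam mu theta x := by
  have hpos := weight_pos hlam hmu htheta
  have hsum := summable_weight hlam hmu htheta hstable
  set Z := ∑' s, weight lam mu theta s
  have hZ : 0 < Z := hsum.tsum_pos (fun s => (hpos s).le) (busy, 0) (hpos _)
  refine ⟨fun s => weight lam mu theta s / Z, ⟨fun s => div_pos (hpos s) hZ, ?_, fun k => ?_,
    fun k => ?_, fun c => ?_⟩⟩
  · exact div_self hZ.ne' ▸ hsum.hasSum.div_const Z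
  · rw [weight_busy, weight_idle]
    field_simp
  · rw [weight_busy, weight_idle, idleWeight]
    field_simp
  · refine .of_nonneg_of_le (fun k => mul_nonneg k.cast_nonneg (div_pos (hpos _) hZ).le)
      (fun k => ?_) ((summable_succ_mul_weight hlam hmu htheta hstable c).div_const Z)
    rw [← mul_div_assoc]
    have := hpos (c, k)
    gcongr
    exact le_add_of_nonneg_right zero_le_one

end Existence

/-- The block of `v Q` at level `k + 1`, where the sequence `v` of row vectors starts at level
`k`. -/
noncomputable def levelBalance (lam mu theta : ℝ) (k : ℕ) (v : ℕ → Fin 2 → ℝ) : Fin 2 → ℝ :=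
  v 0 ᵥ* blockC lam + v 1 ᵥ* blockA lam mu theta (k + 1) + v 2 ᵥ* blockB theta (k + 2) +
    (∑' i, v (i + 3)) ᵥ* blockD theta

section BlockEntries

variable {lam mu theta : ℝ} {i j : ℕ}

lemma Q_self_succ : Q lam mu theta i (i + 1) = blockC lam := by simp [Q]

lemma Q_self : Q lam mu theta i i = blockA lam mu theta (i + 1) := by simp [Q]

lemma Q_succ_self : Q lam mu theta (j + 1) j = blockB theta (j + 2) := by
  unfold Q
  rw [if_neg (by omega), if_neg (by omega), if_pos rfl]

lemma Q_of_succ_lt (hij : j + 1 < i) : Q lam mu theta i j = blockD theta := by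
  unfold Q
  rw [if_neg (by omega), if_neg (by omega), if_neg (by omega), if_pos hij]

lemma Q_eq_zero (hij : i + 1 < j) : Q lam mu theta i j = 0 := by
  unfold Q
  rw [if_neg (by omega), if_neg (by omega), if_neg (by omega), if_neg (by omega)]

end BlockEntries

section LevelBalance

variable {lam mu theta : ℝ}

lemma vecMul_blockA (k : ℕ) (u : Fin 2 → ℝ) : u ᵥ* blockA lam mu theta k =
    ![lam * u idle - (lam + mu) * u busy, mu * u busy - (lam + k * theta) * u idle] := by
  ext c
  fin_cases c <;> simp only [vecMul_fin_two, blockA] <;> simp <;> ring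

lemma vecMul_blockB (k : ℕ) (u : Fin 2 → ℝ) :
    u ᵥ* blockB theta k = ![k * theta * u idle, -(theta * u idle)] := by
  ext c
  fin_cases c <;> simp only [vecMul_fin_two, blockB] <;> simp <;> ring

lemma vecMul_blockC (u : Fin 2 → ℝ) : u ᵥ* blockC lam = ![lam * u busy, 0] := by
  ext c
  fin_cases c <;> simp only [vecMul_fin_two, blockC] <;> simp [mul_comm]

lemma vecMul_blockD (u : Fin 2 → ℝ) :
    u ᵥ* blockD theta = ![theta * u idle, -(theta * u idle)] := by
  ext c
  fin_cases c <;> simp only [vecMul_fin_two, blockD] <;> simp [mul_comm]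

variable {v : ℕ → Fin 2 → ℝ}

lemma levelBalance_idle (hv : Summable v) (k : ℕ) :
    levelBalance lam mu theta k v idle =
      mu * v 1 busy - (lam + (k + 1) * theta) * v 1 idle - theta * ∑' i, v (i + 2) idle := by
  have hidle : Summable fun i => v (i + 2) idle :=
    (Pi.summable.1 hv idle).comp_injective (add_left_injective 2)
  have htail : (∑' i, v (i + 3)) idle = ∑' i, v (i + 1 + 2) idle :=
    tsum_apply (hv.comp_injective (add_left_injective 3))
  rw [hidle.tsum_eq_zero_add]
  simp only [levelBalance, vecMul_blockA, vecMul_blockB, vecMul_blockC, vecMul_blockD,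
    Pi.add_apply, Matrix.cons_val_one, Matrix.cons_val_zero, zero_add, htail]
  push_cast
  ring

lemma levelBalance_busy_add_idle (v : ℕ → Fin 2 → ℝ) (k : ℕ) :
    levelBalance lam mu theta k v busy + levelBalance lam mu theta k v idle =
      lam * (v 0 busy - v 1 busy) - (k + 1) * theta * (v 1 idle - v 2 idle) := by
  simp only [levelBalance, vecMul_blockA, vecMul_blockB, vecMul_blockC, vecMul_blockD,
    Pi.add_apply, Matrix.cons_val_one, Matrix.cons_val_zero]
  push_cast
  ring

lemma hasSum_vecMul_Q (hv : Summable v) (j : ℕ) :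
    HasSum (fun i => v i ᵥ* Q lam mu theta i j)
      (levelBalance lam mu theta j fun i => if j + i = 0 then 0 else v (j + i - 1)) := by
  have hD : HasSum (fun i => v (i + (j + 2)) ᵥ* Q lam mu theta (i + (j + 2)) j)
      ((∑' i, v (i + (j + 2))) ᵥ* blockD theta) := by
    have hQ : ∀ i, Q lam mu theta (i + (j + 2)) j = blockD theta := fun i =>
      Q_of_succ_lt (by omega)
    simp only [hQ]
    exact hasSum_vecMul_const (hv.comp_injective (add_left_injective (j + 2))).hasSum _
  suffices hfin : (levelBalance lam mu theta j fun i => if j + i = 0 then 0 else v (j + i - 1)) =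
      (∑' i, v (i + (j + 2))) ᵥ* blockD theta +
        ∑ i ∈ Finset.range (j + 2), v i ᵥ* Q lam mu theta i j from
    hfin ▸ (hasSum_nat_add_iff (f := fun i => v i ᵥ* Q lam mu theta i j) (j + 2)).1 hD
  have hindex : ∀ i, j + (i + 3) - 1 = i + (j + 2) := by omega
  rw [Finset.sum_range_succ, Finset.sum_range_succ, Q_self, Q_succ_self]
  cases j with
  | zero =>
    simp only [levelBalance, add_zero, ↓reduceIte, Matrix.zero_vecMul, zero_add, one_ne_zero,
      tsub_self, OfNat.ofNat_ne_zero, Nat.add_one_sub_one, Nat.add_eq_zero_iff, and_false,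
      Finset.range_zero, Finset.sum_empty]
    abel
  | succ j =>
    have hzero : ∀ i ∈ Finset.range j, v i ᵥ* Q lam mu theta i (j + 1) = 0 := fun i hi => by
      rw [Q_eq_zero (Nat.succ_lt_succ (Finset.mem_range.1 hi)), Matrix.vecMul_zero]
    rw [Finset.sum_range_succ, Finset.sum_eq_zero hzero, Q_self_succ]
    simp only [levelBalance, add_zero, Nat.add_eq_zero_iff, one_ne_zero, and_false, ↓reduceIte,
      add_tsub_cancel_right, and_self, OfNat.ofNat_ne_zero, Nat.add_one_sub_one, hindex, zero_add]
    abel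

end LevelBalance

namespace IsStationary

variable {lam mu theta : ℝ} {x : State → ℝ}

lemma summable_add (h : IsStationary lam mu theta x) (c : Fin 2) (k : ℕ) :
    Summable fun j : ℕ => x (c, k + j) :=
  h.hasSum.summable.comp_injective (i := fun j : ℕ => (c, k + j)) fun _ _ hij => by simpa using hij

lemma tailPair_pos (h : IsStationary lam mu theta x) (k : ℕ) (c : Fin 2) : 0 < tailPair x k c :=
  (h.summable_add c k).tsum_pos (fun _ => (h.pos _).le) 0 (h.pos _)

lemma tailPair_sub_tailPair_succ (h : IsStationary lam mu theta x) (k : ℕ) (c : Fin 2) :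
    tailPair x k c - tailPair x (k + 1) c = x (c, k) := by
  rw [tailPair, (h.summable_add c k).tsum_eq_zero_add, tailPair, sub_eq_iff_eq_add]
  simp only [add_zero, add_assoc, add_comm 1]

lemma summable_succ_mul (h : IsStationary lam mu theta x) (k : ℕ) (c : Fin 2) :
    Summable fun j : ℕ => ((j : ℝ) + 1) * x (c, k + j) := by
  have hmul : Summable fun j : ℕ => ((k + j : ℕ) : ℝ) * x (c, k + j) :=
    (h.summable_mul c).comp_injective (add_right_injective k)
  refine .of_nonneg_of_le (fun j => mul_nonneg (by positivity) (h.pos _).le) (fun j => ?_)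
    (hmul.add (h.summable_add c k))
  push_cast
  linarith [mul_nonneg k.cast_nonneg (h.pos (c, k + j)).le]

lemma hasSum_tailPair (h : IsStationary lam mu theta x) (k : ℕ) (c : Fin 2) :
    HasSum (fun i => tailPair x (k + i) c) (∑' j : ℕ, ((j : ℝ) + 1) * x (c, k + j)) := by
  simpa only [tailPair, add_assoc] using
    hasSum_tsum_add_of_nonneg (fun j => (h.pos (c, k + j)).le) (h.summable_succ_mul k c).hasSum

lemma summable_tailPair (h : IsStationary lam mu theta x) (k : ℕ) :
    Summable fun i => tailPair x (k + i) :=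
  Pi.summable.2 fun c => (h.hasSum_tailPair k c).summable

lemma cut_tail (h : IsStationary lam mu theta x) :
    lam * tailPair x 0 busy = theta * ∑' i, tailPair x (1 + i) idle := by
  rw [(h.hasSum_tailPair 1 idle).tsum_eq, tailPair, ← tsum_mul_left, ← tsum_mul_left]
  refine tsum_congr fun j => ?_
  rw [zero_add, add_comm 1, ← h.cut]
  ring

lemma balance_tail (h : IsStationary lam mu theta x) (k : ℕ) :
    mu * tailPair x k busy =
      (lam + k * theta) * tailPair x k idle + theta * ∑' i, tailPair x (k + 1 + i) idle := by
  have hshift : HasSum (fun j : ℕ => (j : ℝ) * x (idle, k + j))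
      (∑' i, tailPair x (k + 1 + i) idle) := by
    rw [(h.hasSum_tailPair (k + 1) idle).tsum_eq, ← hasSum_nat_add_iff' 1]
    simpa [add_assoc, add_comm 1] using (h.summable_succ_mul (k + 1) idle).hasSum
  have hidle : HasSum (fun j => x (idle, k + j)) (tailPair x k idle) :=
    (h.summable_add idle k).hasSum
  rw [← ((hidle.mul_left (lam + k * theta)).add (hshift.mul_left theta)).tsum_eq, tailPair,
    ← tsum_mul_left]
  refine tsum_congr fun j => ?_
  rw [h.balance]
  push_cast
  ring

lemma tailPair_zero (h : IsStationary lam mu theta x) (hmu : 0 < mu) :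
    tailPair x 0 = ![lam / mu, 1 - lam / mu] := by
  have htotal : tailPair x 0 busy + tailPair x 0 idle = 1 := by
    have hfib := h.hasSum.prod_fiberwise fun c => (h.hasSum.summable.prod_factor c).hasSum
    simpa [tailPair] using (hasSum_fintype _).unique hfib
  have hcut := h.cut_tail
  have hbal := h.balance_tail 0
  have hbusy : tailPair x 0 busy = lam / mu := by
    rw [eq_div_iff hmu.ne']
    simp only [CharP.cast_eq_zero, zero_mul, add_zero, zero_add] at hbal
    linear_combination hbal - hcut + lam * htotal
  ext c
  fin_cases c
  · exact hbusy
  · exact eq_sub_of_add_eq' (hbusy ▸ htotal)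

lemma levelBalance_tailPair (h : IsStationary lam mu theta x) (k : ℕ) :
    levelBalance lam mu theta k (fun i => tailPair x (k + i)) = 0 := by
  have hidle : levelBalance lam mu theta k (fun i => tailPair x (k + i)) idle = 0 := by
    have hbal := h.balance_tail (k + 1)
    have hindex : ∀ i, k + 1 + 1 + i = k + (i + 2) := by omega
    simp only [hindex] at hbal
    rw [levelBalance_idle (h.summable_tailPair k), hbal]
    push_cast
    ring
  have hsum := levelBalance_busy_add_idle (lam := lam) (mu := mu) (theta := theta)
    (fun i => tailPair x (k + i)) k
  rw [add_zero, h.tailPair_sub_tailPair_succ, h.tailPair_sub_tailPair_succ (k + 1), h.cut,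
    sub_self, hidle, add_zero] at hsum
  ext c
  fin_cases c
  · exact hsum
  · exact hidle

lemma hasSum_tailPair_vecMul_Q (h : IsStationary lam mu theta x) (hmu : 0 < mu) (j : ℕ) :
    HasSum (fun i : ℕ => tailPair x (i + 1) ᵥ* Q lam mu theta i j)
      (if j = 0 then ![-(lam * (lam / mu)), 0] else 0) := by
  have hsum : Summable fun i => tailPair x (i + 1) := by
    simpa only [add_comm] using h.summable_tailPair 1
  convert hasSum_vecMul_Q (lam := lam) (mu := mu) (theta := theta) hsum j
  have hbal := h.levelBalance_tailPair j
  rcases j with _ | j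
  · have hC : ![-(lam * (lam / mu)), 0] = -(tailPair x 0 ᵥ* blockC lam) := by
      simp [vecMul_blockC, h.tailPair_zero hmu]
    rw [if_pos rfl, hC, neg_eq_iff_add_eq_zero]
    refine Eq.trans ?_ hbal
    simp [levelBalance, add_assoc, add_comm 1]
  · rw [if_neg j.succ_ne_zero, ← hbal]
    congr 1 with i
    simp [add_right_comm]

end IsStationary

lemma prodR_succ_left (R : ℕ → Block) (k l : ℕ) :
    prodR R k (l + 1) = R k * prodR R (k + 1) l := by
  induction l with
  | zero => simp [prodR]
  | succ l ih => rw [prodR, ih, prodR, mul_assoc, add_right_comm, add_assoc]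

lemma prodR_add (R : ℕ → Block) (k l m : ℕ) :
    prodR R k (l + m) = prodR R k l * prodR R (k + l) m := by
  induction m with
  | zero => simp [prodR]
  | succ m ih => rw [← add_assoc, prodR, ih, prodR, mul_assoc, add_assoc]

lemma sumR_eq_mul_one_add {R : ℕ → Block} {k : ℕ}
    (h : Summable fun l : ℕ => prodR R (k + 1) (l + 1)) :
    sumR R k = R k * (1 + sumR R (k + 1)) := by
  have hsum : HasSum (fun l => prodR R (k + 1) l) (1 + sumR R (k + 1)) := by
    rw [← hasSum_nat_add_iff' 1]
    simpa [prodR, sumR] using h.hasSum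
  simp only [sumR, prodR_succ_left R k]
  exact (hsum.mul_left (R k)).tsum_eq

lemma IsNonnegSolution.blockC_add_mul_Psi {lam mu theta : ℝ} {R : ℕ → Block}
    (hR : IsNonnegSolution lam mu theta R) {k : ℕ} (hk : 1 ≤ k) :
    blockC lam + R k * Psi lam mu theta R (k + 1) = 0 := by
  rw [← (hR k hk).2.2, Psi]
  noncomm_ring

lemma IsNonnegSolution.levelBalance_vecMul_prodR {lam mu theta : ℝ} {R : ℕ → Block}
    (hR : IsNonnegSolution lam mu theta R) {k : ℕ} (hk : 1 ≤ k) (u : Fin 2 → ℝ) :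
    levelBalance lam mu theta k (fun i => u ᵥ* prodR R k i) = 0 := by
  obtain ⟨-, hsum, heq⟩ := hR k hk
  have htwo : prodR R k 2 = R k * R (k + 1) := by simp [prodR]
  have htail : ∑' i, u ᵥ* prodR R k (i + 3) = u ᵥ* (R k * R (k + 1) * sumR R (k + 2)) := by
    rw [← htwo, sumR, ← (hasSum_const_vecMul (hsum.hasSum.mul_left (prodR R k 2)) u).tsum_eq]
    refine tsum_congr fun i => congrArg (u ᵥ* ·) ?_
    rw [← prodR_add, add_comm 2]
  rw [levelBalance, htail, htwo, ← Matrix.vecMul_zero u, ← heq]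
  simp [prodR, Matrix.vecMul_add, Matrix.vecMul_vecMul]

/-- The candidate for `R_k`: the only matrix with zero second row that maps `Π_k` to `Π_{k+1}`. -/
noncomputable def tailRatio (x : State → ℝ) (k : ℕ) : Block :=
  Matrix.vecMulVec (Pi.single busy (tailPair x k busy)⁻¹) (tailPair x (k + 1))

namespace IsStationary

section TailRatio

variable {lam mu theta : ℝ} {x : State → ℝ} {R : ℕ → Block} {k : ℕ}

lemma prodR_eq_vecMulVec (h : IsStationary lam mu theta x)
    (hR : Set.EqOn R (tailRatio x) (Set.Ici 1)) (hk : 1 ≤ k) (l : ℕ) :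
    prodR R k (l + 1) =
      Matrix.vecMulVec (Pi.single busy (tailPair x k busy)⁻¹) (tailPair x (k + l + 1)) := by
  induction l with
  | zero => simpa [prodR] using! hR hk
  | succ l ih =>
    have hR' : R (k + (l + 1)) = tailRatio x (k + (l + 1)) := hR (hk.trans (Nat.le_add_right ..))
    rw [prodR, ih, hR', tailRatio, Matrix.vecMulVec_mul_vecMulVec, dotProduct_single, ← add_assoc,
      mul_inv_cancel₀ (h.tailPair_pos _ _).ne', one_smul]

lemma tailPair_vecMul_prodR (h : IsStationary lam mu theta x)
    (hR : Set.EqOn R (tailRatio x) (Set.Ici 1)) (hk : 1 ≤ k) (l : ℕ) :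
    tailPair x k ᵥ* prodR R k l = tailPair x (k + l) := by
  cases l with
  | zero => simp [prodR]
  | succ l =>
    rw [h.prodR_eq_vecMulVec hR hk, Matrix.vecMul_vecMulVec, dotProduct_single,
      mul_inv_cancel₀ (h.tailPair_pos _ _).ne', one_smul, add_assoc]

lemma summable_prodR (h : IsStationary lam mu theta x)
    (hR : Set.EqOn R (tailRatio x) (Set.Ici 1)) (hk : 1 ≤ k) :
    Summable fun l => prodR R k (l + 1) := by
  simp only [h.prodR_eq_vecMulVec hR hk]
  refine Pi.summable.2 fun a => Pi.summable.2 fun b => ?_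
  refine Summable.mul_left _ (Pi.summable.1 ((h.summable_tailPair k).comp_injective
    (add_left_injective 1)) b)

lemma tailPair_vecMul_sumR (h : IsStationary lam mu theta x)
    (hR : Set.EqOn R (tailRatio x) (Set.Ici 1)) (hk : 1 ≤ k) :
    tailPair x k ᵥ* sumR R k = ∑' l, tailPair x (k + (l + 1)) := by
  simp only [← h.tailPair_vecMul_prodR hR hk]
  exact (hasSum_const_vecMul (h.summable_prodR hR hk).hasSum _).tsum_eq.symm

lemma tailPair_vecMul_Psi (h : IsStationary lam mu theta x)
    (hR : Set.EqOn R (tailRatio x) (Set.Ici 1)) (k : ℕ) :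
    tailPair x (k + 1) ᵥ* Psi lam mu theta R (k + 1) = -(tailPair x k ᵥ* blockC lam) := by
  have hstep : tailPair x (k + 1) ᵥ* R (k + 1) = tailPair x (k + 2) := by
    simpa [prodR] using h.tailPair_vecMul_prodR hR k.succ_pos 1
  have hsum : tailPair x (k + 2) ᵥ* sumR R (k + 2) = ∑' i, tailPair x (k + (i + 3)) := by
    rw [h.tailPair_vecMul_sumR hR (Nat.le_add_left 1 _)]
    exact tsum_congr fun i => congrArg _ (by omega)
  rw [eq_neg_iff_add_eq_zero, ← h.levelBalance_tailPair k, levelBalance, Psi, Matrix.vecMul_add,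
    Matrix.vecMul_add, ← Matrix.vecMul_vecMul, ← Matrix.vecMul_vecMul, ← Matrix.vecMul_vecMul,
    hstep, hsum, add_zero]
  abel

lemma Psi_idle (hR : Set.EqOn R (tailRatio x) (Set.Ici 1)) (hk : 1 ≤ k) :
    Psi lam mu theta R k idle = blockA lam mu theta k idle := by
  have hzero : ∀ (M : Block) (c : Fin 2), (R k * M) idle c = 0 := fun M c => by
    rw [hR hk, tailRatio, Matrix.vecMulVec_mul]
    simp [Matrix.vecMulVec_apply]
  ext c
  rw [Psi, Matrix.add_apply, Matrix.add_apply, mul_assoc, hzero, hzero, add_zero, add_zero]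

lemma isUnit_Psi (h : IsStationary lam mu theta x) (hlam : 0 < lam) (htheta : 0 < theta)
    (hR : Set.EqOn R (tailRatio x) (Set.Ici 1)) (hk : 1 ≤ k) :
    IsUnit (Psi lam mu theta R k) := by
  obtain ⟨k, rfl⟩ := Nat.exists_eq_add_of_le' hk
  have hPsi := h.tailPair_vecMul_Psi hR k
  have hbusy := congrFun hPsi busy
  have hidle := congrFun hPsi idle
  rw [vecMul_fin_two, Psi_idle hR hk, vecMul_blockC] at hbusy hidle
  simp only [blockA, Matrix.of_apply, Matrix.cons_val_one, Matrix.cons_val_zero, Pi.neg_apply,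
    neg_zero] at hbusy hidle
  have hdet : tailPair x (k + 1) busy * (Psi lam mu theta R (k + 1)).det =
      lam * tailPair x k busy * (lam + (k + 1 : ℕ) * theta) := by
    rw [Matrix.det_fin_two, Psi_idle hR hk]
    simp only [blockA, Matrix.of_apply, Matrix.cons_val_one, Matrix.cons_val_zero]
    linear_combination -(lam + (k + 1 : ℕ) * theta) * hbusy - lam * hidle
  rw [Matrix.isUnit_iff_isUnit_det, isUnit_iff_ne_zero]
  refine right_ne_zero_of_mul (a := tailPair x (k + 1) busy) (hdet ▸ ?_)
  have := h.tailPair_pos k busy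
  positivity

lemma tailPair_one_eq (h : IsStationary lam mu theta x) (hlam : 0 < lam) (hmu : 0 < mu)
    (htheta : 0 < theta) (hR : Set.EqOn R (tailRatio x) (Set.Ici 1)) :
    tailPair x 1 = ![lam * (lam / mu), 0] ᵥ* -(Psi lam mu theta R 1)⁻¹ := by
  have hdet := (Matrix.isUnit_iff_isUnit_det _).1 (h.isUnit_Psi hlam htheta hR le_rfl)
  have hzero : tailPair x 0 ᵥ* blockC lam = ![lam * (lam / mu), 0] := by
    rw [vecMul_blockC, h.tailPair_zero hmu, Matrix.cons_val_zero]
  rw [← hzero, Matrix.vecMul_neg, ← Matrix.neg_vecMul, ← h.tailPair_vecMul_Psi hR 0,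
    Matrix.vecMul_vecMul, zero_add, Matrix.mul_nonsing_inv _ hdet, Matrix.vecMul_one]

lemma isNonnegSolution_tailRatio (h : IsStationary lam mu theta x) :
    IsNonnegSolution lam mu theta (tailRatio x) := by
  intro k _
  refine ⟨fun a b => ?_, h.summable_prodR (Set.eqOn_refl _ _) (Nat.le_add_left 1 _), ?_⟩
  · have hsingle : (0 : Fin 2 → ℝ) ≤ Pi.single busy (tailPair x k busy)⁻¹ :=
      Pi.single_nonneg.2 (inv_nonneg.2 (h.tailPair_pos k busy).le)
    exact mul_nonneg (hsingle a) (h.tailPair_pos _ _).le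
  · have hC : blockC lam = Matrix.vecMulVec (Pi.single busy (tailPair x k busy)⁻¹)
        (tailPair x k ᵥ* blockC lam) := by
      have := (h.tailPair_pos k busy).ne'
      rw [vecMul_blockC]
      ext a b
      fin_cases a <;> fin_cases b <;> simp [Matrix.vecMulVec_apply, blockC]
      field_simp
    have hPsi : tailRatio x k * Psi lam mu theta (tailRatio x) (k + 1) = -blockC lam := by
      rw [tailRatio, Matrix.vecMulVec_mul, h.tailPair_vecMul_Psi (Set.eqOn_refl _ _),
        Matrix.vecMulVec_neg, ← hC]
    rw [← add_neg_cancel (blockC lam), ← hPsi, Psi]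
    noncomm_ring

end TailRatio

section Uniqueness

variable {lam mu theta : ℝ} {x : State → ℝ}

lemma cut_and_balance_of_levelBalance_eq_zero {v : ℕ → Fin 2 → ℝ} (hv : Summable v) {k : ℕ}
    (hbal : ∀ l, levelBalance lam mu theta (k + l) (fun i => v (l + i)) = 0) (l : ℕ) :
    lam * (v l busy - v (l + 1) busy) =
        ((k + l : ℕ) + 1) * theta * (v (l + 1) idle - v (l + 2) idle) ∧
      mu * (v (l + 1) busy - v (l + 2) busy) =
        (lam + ((k + l + 1 : ℕ) : ℝ) * theta) * (v (l + 1) idle - v (l + 2) idle) := by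
  have hshift : ∀ l, Summable fun i => v (l + i) := fun l =>
    hv.comp_injective (add_right_injective l)
  constructor
  · have hsum := levelBalance_busy_add_idle (lam := lam) (mu := mu) (theta := theta)
      (fun i => v (l + i)) (k + l)
    rw [hbal, Pi.zero_apply, Pi.zero_apply, zero_add] at hsum
    exact sub_eq_zero.1 hsum.symm
  · have hidle : ∀ l, mu * v (l + 1) busy = (lam + ((k + l : ℕ) + 1) * theta) * v (l + 1) idle +
        theta * ∑' i, v (l + 2 + i) idle := fun l => by
      have heq := levelBalance_idle (lam := lam) (mu := mu) (theta := theta) (hshift l) (k + l)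
      have hindex : ∑' i, v (l + (i + 2)) idle = ∑' i, v (l + 2 + i) idle :=
        tsum_congr fun i => by rw [add_comm i, add_assoc]
      rw [hbal, Pi.zero_apply, hindex] at heq
      linear_combination -heq
    have htail : ∑' i, v (l + 2 + i) idle = v (l + 2) idle + ∑' i, v (l + 1 + 2 + i) idle := by
      rw [(Pi.summable.1 (hshift (l + 2)) idle).tsum_eq_zero_add]
      exact congrArg _ (tsum_congr fun i => congrArg (fun n => v n idle) (by omega))
    have hcur := hidle l
    have hsucc := hidle (l + 1)
    push_cast at hcur hsucc ⊢
    linear_combination hcur - hsucc + theta * htail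

lemma exists_sub_succ_eq_mul (h : IsStationary lam mu theta x) (hmu : 0 < mu) (htheta : 0 < theta)
    {v : ℕ → Fin 2 → ℝ} (hv : Summable v) {k : ℕ}
    (hbal : ∀ l, levelBalance lam mu theta (k + l) (fun i => v (l + i)) = 0) :
    ∃ β : ℝ, ∀ l, v l busy - v (l + 1) busy = β * x (busy, k + l) ∧
      v (l + 1) idle - v (l + 2) idle = β * x (idle, k + l + 1) := by
  have hdiff := cut_and_balance_of_levelBalance_eq_zero hv hbal
  refine ⟨(v 0 busy - v 1 busy) / x (busy, k), fun l => ?_⟩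
  set β := (v 0 busy - v 1 busy) / x (busy, k)
  have hstep : ∀ l, v l busy - v (l + 1) busy = β * x (busy, k + l) →
      v (l + 1) idle - v (l + 2) idle = β * x (idle, k + l + 1) := fun l hl => by
    refine mul_left_cancel₀ (a := ((k + l : ℕ) + 1) * theta) (by positivity) ?_
    linear_combination lam * hl - (hdiff l).1 - β * h.cut (k + l)
  suffices hbusy : v l busy - v (l + 1) busy = β * x (busy, k + l) from ⟨hbusy, hstep l hbusy⟩
  induction l with
  | zero => exact (div_mul_cancel₀ _ (h.pos _).ne').symm
  | succ l ih =>
    refine mul_left_cancel₀ hmu.ne' ?_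
    rw [(hdiff l).2, hstep l ih, ← add_assoc]
    linear_combination -β * h.balance (k + l + 1)

lemma eq_smul_tailPair (h : IsStationary lam mu theta x) (hmu : 0 < mu) (htheta : 0 < theta)
    {v : ℕ → Fin 2 → ℝ} (hv : Summable v) {k : ℕ}
    (hbal : ∀ l, levelBalance lam mu theta (k + l) (fun i => v (l + i)) = 0) :
    v 1 = (v 0 busy / tailPair x k busy) • tailPair x (k + 1) := by
  obtain ⟨β, hβ⟩ := h.exists_sub_succ_eq_mul hmu htheta hv hbal
  have hlim : ∀ n c, Tendsto (fun l => v (l + n) c - β * tailPair x (k + l + n) c) atTop (𝓝 0) := by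
    intro n c
    have hv0 := (Pi.summable.1 hv c).tendsto_atTop_zero
    have hx0 := ((Pi.summable.1 (h.summable_tailPair k) c).tendsto_atTop_zero).const_mul β
    simpa only [Function.comp_def, ← add_assoc, mul_zero, sub_zero] using
      (hv0.sub hx0).comp (tendsto_add_atTop_nat n)
  have hbusy : ∀ l, v l busy - β * tailPair x (k + l) busy = 0 :=
    eq_of_succ_eq_of_tendsto (fun l => by
      linear_combination β * h.tailPair_sub_tailPair_succ (k + l) busy - (hβ l).1) (hlim 0 busy)
  have hidle : ∀ l, v (l + 1) idle - β * tailPair x (k + l + 1) idle = 0 :=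
    eq_of_succ_eq_of_tendsto (fun l => by
      linear_combination β * h.tailPair_sub_tailPair_succ (k + l + 1) idle - (hβ l).2)
      (hlim 1 idle)
  have hv0 : v 0 busy / tailPair x k busy = β := by
    rw [div_eq_iff (h.tailPair_pos k busy).ne']
    exact sub_eq_zero.1 (hbusy 0)
  rw [hv0]
  ext c
  fin_cases c
  · exact sub_eq_zero.1 (hbusy 1)
  · exact sub_eq_zero.1 (hidle 0)

lemma eqOn_tailRatio (h : IsStationary lam mu theta x) (hmu : 0 < mu) (htheta : 0 < theta)
    {S : ℕ → Block} (hS : IsNonnegSolution lam mu theta S) :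
    Set.EqOn S (tailRatio x) (Set.Ici 1) := by
  intro k hk
  replace hk : 1 ≤ k := hk
  refine Matrix.ext_of_single_vecMul fun a => ?_
  set u : Fin 2 → ℝ := Pi.single a 1
  have hsum : Summable fun l => prodR S k l := by
    have htail := (hS k hk).2.1.mul_left (prodR S k 2)
    simp only [← prodR_add] at htail
    exact (summable_nat_add_iff (f := fun l => prodR S k l) 3).1
      (htail.congr fun l => congrArg (prodR S k) (by omega))
  have hbal : ∀ l, levelBalance lam mu theta (k + l) (fun i => u ᵥ* prodR S k (l + i)) = 0 :=
    fun l => by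
      simp only [prodR_add, ← Matrix.vecMul_vecMul]
      exact hS.levelBalance_vecMul_prodR (by omega) _
  have heq := h.eq_smul_tailPair hmu htheta (hasSum_const_vecMul hsum.hasSum u).summable hbal
  simp only [prodR, Matrix.vecMul_one, one_mul, add_zero] at heq
  rw [heq, tailRatio, Matrix.vecMul_vecMulVec, dotProduct_single, div_eq_mul_inv]

lemma isRMeasure_tailRatio (h : IsStationary lam mu theta x) (hmu : 0 < mu) (htheta : 0 < theta) :
    IsRMeasure lam mu theta (tailRatio x) :=
  ⟨h.isNonnegSolution_tailRatio, fun _ hS k hk a b => by rw [h.eqOn_tailRatio hmu htheta hS hk]⟩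

end Uniqueness

end IsStationary

section Factorization

variable {lam mu theta : ℝ} {R : ℕ → Block} {i j : ℕ}

lemma factorGL_succ_self :
    factorGL lam mu theta R (j + 1) j = Gsub lam mu theta R (j + 2) := by
  simp [factorGL]

lemma factorGL_of_succ_lt (hij : j + 1 < i) :
    factorGL lam mu theta R i j = Glow lam mu theta R (i + 1) := by
  rw [factorGL, if_neg hij.ne, if_pos hij]

lemma factorGL_eq_zero (hij : i ≤ j) : factorGL lam mu theta R i j = 0 := by
  rw [factorGL, if_neg (by omega), if_neg (by omega)]

lemma blockMul_one_sub_factorRU_diagonal (R d : ℕ → Block) (i j : ℕ) :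
    blockMul (1 - factorRU R) (Matrix.diagonal d) i j =
      if j = i then d i else if j = i + 1 then -(R (i + 1) * d (i + 1)) else 0 := by
  rw [blockMul, tsum_eq_single j fun l hl => by rw [Matrix.diagonal_apply_ne _ hl, mul_zero],
    Matrix.diagonal_apply_eq, Matrix.sub_apply, factorRU, Matrix.one_apply]
  rcases eq_or_ne j i with rfl | hi
  · simp
  · rcases eq_or_ne j (i + 1) with rfl | hsucc
    · simp
    · simp [hi, hi.symm, hsucc]

lemma blockMul_of_bidiagonal {d u : ℕ → Block} {M : Matrix ℕ ℕ Block}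
    (hM : ∀ i j, M i j = if j = i then d i else if j = i + 1 then u i else 0)
    (N : Matrix ℕ ℕ Block) (i j : ℕ) :
    blockMul M N i j = d i * N i j + u i * N (i + 1) j := by
  rw [blockMul, tsum_eq_sum (s := {i, i + 1}) fun l hl => by
      simp only [Finset.mem_insert, Finset.mem_singleton, not_or] at hl
      rw [hM, if_neg hl.1, if_neg hl.2, zero_mul],
    Finset.sum_pair i.lt_succ_self.ne, hM, hM, if_pos rfl, if_neg (by omega), if_pos rfl]

lemma blockMul_factorUD_one_sub_apply (N : Matrix ℕ ℕ Block) (i j : ℕ) :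
    blockMul (blockMul (1 - factorRU R) (factorUD lam mu theta R)) (1 - N) i j =
      Psi lam mu theta R (i + 1) * ((1 : Matrix ℕ ℕ Block) i j - N i j) -
        R (i + 1) * (Psi lam mu theta R (i + 2) *
          ((1 : Matrix ℕ ℕ Block) (i + 1) j - N (i + 1) j)) := by
  rw [factorUD, blockMul_of_bidiagonal (blockMul_one_sub_factorRU_diagonal R _), neg_mul,
    ← sub_eq_add_neg, mul_assoc]
  rfl

lemma Psi_mul_neg_Psi_inv_mul {k : ℕ} (hk : IsUnit (Psi lam mu theta R k)) (M : Block) :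
    Psi lam mu theta R k * ((-Psi lam mu theta R k)⁻¹ * M) = -M := by
  rw [← neg_neg (Psi lam mu theta R k * _), ← neg_mul, Matrix.mul_nonsing_inv_cancel_left]
  exact (Matrix.isUnit_iff_isUnit_det _).1 hk.neg

lemma eq_blockC_mul_neg_Psi_inv {S : Block} {k : ℕ} (hk : IsUnit (Psi lam mu theta R k))
    (heq : blockC lam + S * Psi lam mu theta R k = 0) :
    S = blockC lam * (-Psi lam mu theta R k)⁻¹ := by
  rw [eq_neg_of_add_eq_zero_left heq, ← mul_neg, Matrix.mul_nonsing_inv_cancel_right]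
  exact (Matrix.isUnit_iff_isUnit_det _).1 hk.neg

lemma Psi_mul_Gsub {k : ℕ} (hk : IsUnit (Psi lam mu theta R k)) :
    Psi lam mu theta R k * Gsub lam mu theta R k = -(blockB theta k + sumR R k * blockD theta) :=
  Psi_mul_neg_Psi_inv_mul hk _

lemma Psi_mul_Glow {k : ℕ} (hk : IsUnit (Psi lam mu theta R k)) :
    Psi lam mu theta R k * Glow lam mu theta R k = -((1 + sumR R k) * blockD theta) := by
  rw [Glow, mul_assoc, Psi_mul_neg_Psi_inv_mul hk]

lemma Q_eq_blockMul (hunit : ∀ k, 1 ≤ k → IsUnit (Psi lam mu theta R k))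
    (heq : ∀ k, 1 ≤ k → blockC lam + R k * Psi lam mu theta R (k + 1) = 0)
    (hsum : ∀ k, 1 ≤ k → Summable fun l : ℕ => prodR R k (l + 1)) :
    Q lam mu theta = blockMul (blockMul (1 - factorRU R) (factorUD lam mu theta R))
      (1 - factorGL lam mu theta R) := by
  ext1 i j
  rw [blockMul_factorUD_one_sub_apply]
  have hPsi := hunit (i + 1) (by omega)
  have hPsi' := hunit (i + 2) (by omega)
  have hsumR := sumR_eq_mul_one_add (hsum (i + 2) (by omega))
  rcases lt_trichotomy j i with hij | rfl | hij
  · rw [Matrix.one_apply_ne hij.ne', Matrix.one_apply_ne (by omega : i + 1 ≠ j),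
      factorGL_of_succ_lt (by omega : j + 1 < i + 1), zero_sub, zero_sub, mul_neg, mul_neg,
      Psi_mul_Glow hPsi']
    obtain rfl | hij : i = j + 1 ∨ j + 1 < i := by omega
    · rw [Q_succ_self, factorGL_succ_self, Psi_mul_Gsub hPsi, hsumR]
      noncomm_ring
    · rw [Q_of_succ_lt hij, factorGL_of_succ_lt hij, Psi_mul_Glow hPsi, hsumR]
      noncomm_ring
  · rw [Q_self, Matrix.one_apply_eq, Matrix.one_apply_ne j.succ_ne_self, factorGL_eq_zero le_rfl,
      factorGL_succ_self, zero_sub, mul_neg, Psi_mul_Gsub hPsi', Psi]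
    noncomm_ring
  · rw [Matrix.one_apply_ne hij.ne, factorGL_eq_zero hij.le, factorGL_eq_zero hij]
    obtain rfl | hij : j = i + 1 ∨ i + 1 < j := by omega
    · rw [Q_self_succ, Matrix.one_apply_eq, eq_neg_of_add_eq_zero_left (heq (i + 1) (by omega))]
      noncomm_ring
    · rw [Q_eq_zero hij, Matrix.one_apply_ne hij.ne]
      noncomm_ring

end Factorization

section Calculus

lemma hasDerivAt_of_subgradient {f f' : ℝ → ℝ} {a : ℝ} (hf' : ContinuousAt f' a)
    (h : ∀ y z, f' y * (z - y) ≤ f z - f y) : HasDerivAt f (f' a) a := by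
  rw [hasDerivAt_iff_isLittleO, Asymptotics.isLittleO_iff]
  intro ε hε
  filter_upwards [Metric.continuousAt_iff'.1 hf' ε hε] with b hb
  have hnonneg : 0 ≤ f b - f a - (b - a) * f' a := by linarith [h a b]
  rw [smul_eq_mul, Real.norm_of_nonneg hnonneg]
  calc f b - f a - (b - a) * f' a ≤ (f' b - f' a) * (b - a) := by linarith [h b a]
    _ ≤ |f' b - f' a| * |b - a| := (le_abs_self _).trans (abs_mul _ _).le
    _ ≤ ε * ‖b - a‖ := mul_le_mul_of_nonneg_right (Real.dist_eq _ _ ▸ hb.le) (abs_nonneg _)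

lemma tendsto_zero_of_integrableOn_sq {q : ℝ → ℝ} {a B L : ℝ}
    (hint : IntegrableOn (fun t => q t ^ 2) (Set.Ioi a))
    (hdiff : ∀ t ∈ Set.Ioi a, DifferentiableAt ℝ q t) (hB : ∀ t ∈ Set.Ioi a, |q t| ≤ B)
    (hL : ∀ t ∈ Set.Ioi a, |deriv q t| ≤ L) : Tendsto q atTop (𝓝 0) := by
  have hmeas : AEStronglyMeasurable q (volume.restrict (Set.Ioi a)) :=
    ContinuousOn.aestronglyMeasurable
      (fun t ht => (hdiff t ht).continuousAt.continuousWithinAt) measurableSet_Ioi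
  have hcube : Tendsto (fun t => q t ^ 3) atTop (𝓝 0) := by
    refine tendsto_zero_of_hasDerivAt_of_integrableOn_Ioi (a := a)
      (f' := fun t => 3 * (q t ^ 2 * deriv q t)) (fun t ht => ?_) ?_ ?_
    · exact ((hdiff t ht).hasDerivAt.pow 3).congr_deriv (by simp [mul_assoc])
    · exact (hint.mul_bdd (measurable_deriv q).aestronglyMeasurable
        (ae_restrict_of_forall_mem measurableSet_Ioi hL)).const_mul 3
    · simp only [pow_succ _ 2]
      exact hint.mul_bdd hmeas (ae_restrict_of_forall_mem measurableSet_Ioi hB)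
  have hroot : ∀ t, |q t| = |q t ^ 3| ^ (((3 : ℕ) : ℝ)⁻¹) := fun t => by
    rw [abs_pow, Real.pow_rpow_inv_natCast (abs_nonneg _) three_ne_zero]
  rw [tendsto_zero_iff_abs_tendsto_zero]
  simp only [Function.comp_def, hroot]
  simpa using! hcube.abs.rpow_const (p := ((3 : ℕ) : ℝ)⁻¹) (.inr (by positivity))

end Calculus

section SoftPos

/-- A differentiable convex function that vanishes exactly on `(-∞, c]` and grows linearly: it
serves as a smooth substitute for the positive part of `y - c`. -/
noncomputable def softPos (c y : ℝ) : ℝ := max (y - c) 0 ^ 2 / (1 + max (y - c) 0)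

/-- The derivative of `softPos c`. -/
noncomputable def softPosDeriv (c y : ℝ) : ℝ := 1 - 1 / (1 + max (y - c) 0) ^ 2

variable {c y : ℝ}

lemma softPos_eq_zero (h : y ≤ c) : softPos c y = 0 := by
  simp [softPos, max_eq_right (sub_nonpos.2 h)]

lemma softPos_pos (h : c < y) : 0 < softPos c y := by
  have : 0 < max (y - c) 0 := lt_max_of_lt_left (sub_pos.2 h)
  unfold softPos
  positivity

lemma softPos_nonneg (c y : ℝ) : 0 ≤ softPos c y := by
  unfold softPos
  positivity

lemma softPos_le (hc : 0 ≤ c) (hy : 0 ≤ y) : softPos c y ≤ y := by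
  have hmax : max (y - c) 0 ≤ y := max_le (by linarith) hy
  have hnonneg : 0 ≤ max (y - c) 0 := le_max_right _ _
  rw [softPos, div_le_iff₀ (by positivity)]
  nlinarith

lemma softPosDeriv_mul_le (c y z : ℝ) :
    softPosDeriv c y * (z - y) ≤ softPos c z - softPos c y := by
  have hlin : softPosDeriv c y * (z - y) ≤
      softPosDeriv c y * (max (z - c) 0 - max (y - c) 0) := by
    rcases le_or_gt y c with h | h
    · simp [softPosDeriv, max_eq_right (sub_nonpos.2 h)]
    · have hderiv : 0 ≤ softPosDeriv c y := by
        rw [softPosDeriv, sub_nonneg]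
        exact div_le_one_of_le₀ (one_le_pow₀ (le_add_of_nonneg_right (le_max_right _ _)))
          (by positivity)
      rw [max_eq_left (sub_pos.2 h).le]
      exact mul_le_mul_of_nonneg_left (by linarith [le_max_left (z - c) 0]) hderiv
  refine hlin.trans (sub_nonneg.1 ?_)
  unfold softPos softPosDeriv
  have hY : 0 ≤ max (y - c) 0 := le_max_right _ _
  have hZ : 0 ≤ max (z - c) 0 := le_max_right _ _
  generalize max (y - c) 0 = Y at *
  generalize max (z - c) 0 = Z at *
  have hsq : Z ^ 2 / (1 + Z) - Y ^ 2 / (1 + Y) - (1 - 1 / (1 + Y) ^ 2) * (Z - Y) =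
      (Z - Y) ^ 2 / ((1 + Y) ^ 2 * (1 + Z)) := by
    field_simp
    ring
  rw [hsq]
  positivity

lemma hasDerivAt_softPos (c y : ℝ) : HasDerivAt (softPos c) (softPosDeriv c y) y := by
  refine hasDerivAt_of_subgradient (Continuous.continuousAt ?_) (softPosDeriv_mul_le c)
  have hne : ∀ y : ℝ, (1 + max (y - c) 0) ^ 2 ≠ 0 := fun y => by positivity
  unfold softPosDeriv
  fun_prop (disch := exact hne _)

end SoftPos

section ReverseGenerator

/-- The action of the forward Kolmogorov equations on a mass distribution `p`. -/
noncomputable def forward (lam mu theta : ℝ) (p : State → ℝ) (s : State) : ℝ :=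
  if s.1 = busy then
    (if s.2 = 0 then 0 else lam * p (busy, s.2 - 1)) - (lam + mu) * p (busy, s.2) +
      lam * p (idle, s.2) + (s.2 + 1) * theta * p (idle, s.2 + 1)
  else mu * p (busy, s.2) - (lam + s.2 * theta) * p (idle, s.2)

/-- The generator of the time reversal of the stationary queue. It governs the density of a
solution of the forward equations with respect to the stationary distribution. -/
noncomputable def reverseGenerator (lam mu theta : ℝ) (r : State → ℝ) (s : State) : ℝ :=
  if s.1 = busy then
    mu / (lam + s.2 * theta) * (s.2 * theta * (r (busy, s.2 - 1) - r (busy, s.2)) +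
      lam * (r (idle, s.2) - r (busy, s.2))) + lam * (r (idle, s.2 + 1) - r (busy, s.2))
  else (lam + s.2 * theta) * (r (busy, s.2) - r (idle, s.2))

/-- The total `φ`-energy of a density `r` on the levels `0, …, n`. -/
noncomputable def energy (x : State → ℝ) (φ : ℝ → ℝ) (r : State → ℝ) (n : ℕ) : ℝ :=
  ∑ k ∈ Finset.range (n + 1), ∑ c, x (c, k) * φ (r (c, k))

/-- The loss of quadratic energy of a density `r` along the transitions `(W, k) → (I, k)` and
`(I, k + 1) → (W, k)` of the reversed queue, `0 ≤ k ≤ n`. -/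
noncomputable def dissipation (lam mu : ℝ) (x r : State → ℝ) (n : ℕ) : ℝ :=
  ∑ k ∈ Finset.range (n + 1), (mu * x (busy, k) * (r (busy, k) - r (idle, k)) ^ 2 +
    lam * x (busy, k) * (r (idle, k + 1) - r (busy, k)) ^ 2)

variable {lam mu theta : ℝ}

lemma forward_busy (p : State → ℝ) (k : ℕ) : forward lam mu theta p (busy, k) =
    (if k = 0 then 0 else lam * p (busy, k - 1)) - (lam + mu) * p (busy, k) +
      lam * p (idle, k) + (k + 1) * theta * p (idle, k + 1) := rfl

lemma forward_idle (p : State → ℝ) (k : ℕ) : forward lam mu theta p (idle, k) =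
    mu * p (busy, k) - (lam + k * theta) * p (idle, k) := rfl

lemma reverseGenerator_busy (r : State → ℝ) (k : ℕ) :
    reverseGenerator lam mu theta r (busy, k) =
      mu / (lam + k * theta) * (k * theta * (r (busy, k - 1) - r (busy, k)) +
        lam * (r (idle, k) - r (busy, k))) + lam * (r (idle, k + 1) - r (busy, k)) := rfl

lemma reverseGenerator_idle (r : State → ℝ) (k : ℕ) :
    reverseGenerator lam mu theta r (idle, k) =
      (lam + k * theta) * (r (busy, k) - r (idle, k)) := rfl

lemma exists_abs_reverseGenerator_le (lam mu theta : ℝ) (s : State) :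
    ∃ L, ∀ (r : State → ℝ) (c : ℝ), (∀ s s', |r s - r s'| ≤ c) →
      |reverseGenerator lam mu theta r s| ≤ L * c := by
  have hmul : ∀ (a : ℝ) {d c : ℝ}, |d| ≤ c → |a * d| ≤ |a| * c := fun a d c h =>
    (abs_mul a d).trans_le (mul_le_mul_of_nonneg_left h (abs_nonneg a))
  obtain ⟨a, k⟩ := s
  fin_cases a
  · refine ⟨|mu / (lam + k * theta)| * (|k * theta| + |lam|) + |lam|, fun r c h => ?_⟩
    rw [add_mul, mul_assoc, add_mul]
    exact (abs_add_le _ _).trans (add_le_add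
      (hmul _ ((abs_add_le _ _).trans (add_le_add (hmul _ (h _ _)) (hmul _ (h _ _)))))
      (hmul _ (h _ _)))
  · exact ⟨|lam + k * theta|, fun r c h => hmul _ (h _ _)⟩

namespace IsStationary

variable {x : State → ℝ}

lemma mul_reverseGenerator_busy (h : IsStationary lam mu theta x) (hlam : 0 < lam)
    (htheta : 0 < theta) (r : State → ℝ) (k : ℕ) :
    x (busy, k) * reverseGenerator lam mu theta r (busy, k) =
      k * theta * x (idle, k) * (r (busy, k - 1) - r (busy, k)) +
        lam * x (idle, k) * (r (idle, k) - r (busy, k)) +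
        lam * x (busy, k) * (r (idle, k + 1) - r (busy, k)) := by
  have hratio : x (busy, k) * (mu / (lam + k * theta)) = x (idle, k) := by
    rw [mul_div_assoc', div_eq_iff (by positivity), mul_comm, h.balance, mul_comm]
  rw [reverseGenerator_busy]
  linear_combination (k * theta * (r (busy, k - 1) - r (busy, k)) +
    lam * (r (idle, k) - r (busy, k))) * hratio

lemma mul_reverseGenerator_idle (h : IsStationary lam mu theta x) (r : State → ℝ) (k : ℕ) :
    x (idle, k) * reverseGenerator lam mu theta r (idle, k) =
      mu * x (busy, k) * (r (busy, k) - r (idle, k)) := by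
  rw [reverseGenerator_idle, h.balance]
  ring

lemma forward_mul (h : IsStationary lam mu theta x) (hlam : 0 < lam) (htheta : 0 < theta)
    (r : State → ℝ) : forward lam mu theta (x * r) = x * reverseGenerator lam mu theta r := by
  ext ⟨a, k⟩
  fin_cases a
  · have hcut : (if k = 0 then 0 else lam * (x (busy, k - 1) * r (busy, k - 1))) =
        k * theta * x (idle, k) * r (busy, k - 1) := by
      cases k with
      | zero => simp
      | succ k =>
        rw [if_neg k.succ_ne_zero, Nat.add_sub_cancel, Nat.cast_succ, h.cut, mul_assoc]
    refine Eq.trans ?_ (h.mul_reverseGenerator_busy hlam htheta r k).symm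
    simp only [Fin.zero_eta, forward_busy, Pi.mul_apply, hcut]
    linear_combination r (idle, k + 1) * h.cut k - r (busy, k) * h.balance k
  · refine Eq.trans ?_ (h.mul_reverseGenerator_idle r k).symm
    simp only [Fin.mk_one, forward_idle, Pi.mul_apply]
    linear_combination r (idle, k) * h.balance k

lemma sum_deriv_mul_reverseGenerator_le (h : IsStationary lam mu theta x) (hlam : 0 < lam)
    (hmu : 0 < mu) (htheta : 0 < theta) {φ φ' : ℝ → ℝ} {κ : ℝ} (hκ : 0 ≤ κ)
    (hconv : ∀ y z, φ' y * (z - y) ≤ φ z - φ y - κ * (z - y) ^ 2) (r : State → ℝ) (k : ℕ) :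
    ∑ c, x (c, k) * (φ' (r (c, k)) * reverseGenerator lam mu theta r (c, k)) ≤
      k * theta * x (idle, k) * (φ (r (busy, k - 1)) - φ (r (idle, k))) -
        lam * x (busy, k) * (φ (r (busy, k)) - φ (r (idle, k + 1))) -
        κ * (mu * x (busy, k) * (r (busy, k) - r (idle, k)) ^ 2 +
          lam * x (busy, k) * (r (idle, k + 1) - r (busy, k)) ^ 2) := by
  have hW := h.pos (busy, k)
  have hI := h.pos (idle, k)
  have hconv₀ : ∀ y z, φ' y * (z - y) ≤ φ z - φ y := fun y z =>
    (hconv y z).trans (sub_le_self _ (by positivity))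
  have hretrial := mul_le_mul_of_nonneg_left (hconv₀ (r (busy, k)) (r (busy, k - 1)))
    (by positivity : 0 ≤ k * theta * x (idle, k))
  have harrival := mul_le_mul_of_nonneg_left (hconv₀ (r (busy, k)) (r (idle, k)))
    (by positivity : 0 ≤ lam * x (idle, k))
  have horbit := mul_le_mul_of_nonneg_left (hconv (r (busy, k)) (r (idle, k + 1)))
    (by positivity : 0 ≤ lam * x (busy, k))
  have hservice := mul_le_mul_of_nonneg_left (hconv (r (idle, k)) (r (busy, k)))
    (by positivity : 0 ≤ mu * x (busy, k))
  have hbalance : mu * x (busy, k) * (φ (r (busy, k)) - φ (r (idle, k))) =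
      (lam + k * theta) * x (idle, k) * (φ (r (busy, k)) - φ (r (idle, k))) := by rw [h.balance]
  rw [Fin.sum_univ_two, mul_left_comm, h.mul_reverseGenerator_busy hlam htheta,
    mul_left_comm (x (idle, k)), h.mul_reverseGenerator_idle]
  linarith

lemma sum_range_deriv_mul_reverseGenerator_le (h : IsStationary lam mu theta x) (hlam : 0 < lam)
    (hmu : 0 < mu) (htheta : 0 < theta) {φ φ' : ℝ → ℝ} {κ : ℝ} (hκ : 0 ≤ κ) (hφ : ∀ y, 0 ≤ φ y)
    (hconv : ∀ y z, φ' y * (z - y) ≤ φ z - φ y - κ * (z - y) ^ 2) (r : State → ℝ) (n : ℕ) :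
    ∑ k ∈ Finset.range (n + 1),
        ∑ c, x (c, k) * (φ' (r (c, k)) * reverseGenerator lam mu theta r (c, k)) ≤
      lam * x (busy, n) * φ (r (idle, n + 1)) - κ * dissipation lam mu x r n := by
  set flux : ℕ → ℝ := fun k => k * theta * x (idle, k) * (φ (r (busy, k - 1)) - φ (r (idle, k)))
  have hflux : ∀ k, flux (k + 1) =
      lam * x (busy, k) * (φ (r (busy, k)) - φ (r (idle, k + 1))) := fun k => by
    simp only [flux, Nat.add_sub_cancel, Nat.cast_succ, h.cut]
  have htelescope := Finset.sum_range_sub' flux (n + 1)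
  have hlast : 0 ≤ lam * x (busy, n) * φ (r (busy, n)) :=
    mul_nonneg (mul_pos hlam (h.pos _)).le (hφ _)
  calc _ ≤ ∑ k ∈ Finset.range (n + 1), (flux k - flux (k + 1) -
          κ * (mu * x (busy, k) * (r (busy, k) - r (idle, k)) ^ 2 +
            lam * x (busy, k) * (r (idle, k + 1) - r (busy, k)) ^ 2)) :=
        Finset.sum_le_sum fun k _ => (hflux k).symm ▸
          h.sum_deriv_mul_reverseGenerator_le hlam hmu htheta hκ hconv r k
    _ = flux 0 - flux (n + 1) - κ * dissipation lam mu x r n := by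
        rw [Finset.sum_sub_distrib, htelescope, ← Finset.mul_sum, dissipation]
    _ ≤ _ := by
        rw [hflux]
        simp only [flux, CharP.cast_eq_zero, zero_mul]
        linarith

end IsStationary

end ReverseGenerator

lemma mul_le_energy {x : State → ℝ} {φ : ℝ → ℝ} (hx : ∀ s, 0 ≤ x s) (hφ : ∀ y, 0 ≤ φ y)
    (r : State → ℝ) {s : State} {n : ℕ} (hs : s.2 ≤ n) : x s * φ (r s) ≤ energy x φ r n := by
  have hterm : ∀ k c, 0 ≤ x (c, k) * φ (r (c, k)) := fun k c => mul_nonneg (hx _) (hφ _)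
  exact (Finset.single_le_sum (f := fun c => x (c, s.2) * φ (r (c, s.2)))
    (fun c _ => hterm s.2 c) (Finset.mem_univ s.1)).trans (Finset.single_le_sum
      (fun k _ => Finset.sum_nonneg fun c _ => hterm k c)
      (Finset.mem_range.2 (Nat.lt_succ_of_le hs)))

namespace IsStationary

variable {lam mu theta : ℝ} {x r : State → ℝ}

lemma energy_sq_le (h : IsStationary lam mu theta x) {c : ℝ} (hr : ∀ s, 0 ≤ r s)
    (hrc : ∀ s, r s ≤ c) (n : ℕ) : energy x (· ^ 2) r n ≤ c ^ 2 := by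
  have hmass : ∑ k ∈ Finset.range (n + 1), ∑ a, x (a, k) ≤ 1 := by
    rw [← Finset.sum_product_right']
    exact sum_le_hasSum _ (fun s _ => (h.pos s).le) h.hasSum
  calc energy x (· ^ 2) r n ≤ ∑ k ∈ Finset.range (n + 1), ∑ a, x (a, k) * c ^ 2 :=
        Finset.sum_le_sum fun k _ => Finset.sum_le_sum fun a _ =>
          mul_le_mul_of_nonneg_left (pow_le_pow_left₀ (hr _) (hrc _) 2) (h.pos _).le
    _ = (∑ k ∈ Finset.range (n + 1), ∑ a, x (a, k)) * c ^ 2 := by simp only [Finset.sum_mul]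
    _ ≤ c ^ 2 := mul_le_of_le_one_left (sq_nonneg c) hmass

lemma monotone_dissipation (h : IsStationary lam mu theta x) (hlam : 0 ≤ lam) (hmu : 0 ≤ mu)
    (r : State → ℝ) : Monotone (dissipation lam mu x r) := fun m n hmn =>
  Finset.sum_le_sum_of_subset_of_nonneg (Finset.range_mono (Nat.succ_le_succ hmn)) fun k _ _ => by
    have := h.pos (busy, k)
    positivity

lemma term_le_dissipation (h : IsStationary lam mu theta x) (hlam : 0 ≤ lam) (hmu : 0 ≤ mu)
    (r : State → ℝ) (k : ℕ) :
    mu * x (busy, k) * (r (busy, k) - r (idle, k)) ^ 2 +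
      lam * x (busy, k) * (r (idle, k + 1) - r (busy, k)) ^ 2 ≤ dissipation lam mu x r k :=
  Finset.single_le_sum (f := fun k => mu * x (busy, k) * (r (busy, k) - r (idle, k)) ^ 2 +
    lam * x (busy, k) * (r (idle, k + 1) - r (busy, k)) ^ 2)
    (fun k _ => by have := h.pos (busy, k); positivity) (Finset.self_mem_range_succ k)

end IsStationary

/-- `p` solves the forward Kolmogorov equations, has nonnegative values and constant total mass
`m`. -/
structure IsForwardSolution (lam mu theta m : ℝ) (p : ℝ → State → ℝ) : Prop where
  nonneg : ∀ t s, 0 ≤ p t s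
  hasSum : ∀ t, HasSum (p t) m
  continuous : ∀ s, Continuous fun t => p t s
  hasDerivAt : ∀ s t, 0 < t → HasDerivAt (fun t => p t s) (forward lam mu theta (p t) s) t

namespace IsForwardSolution

variable {lam mu theta m : ℝ} {x : State → ℝ} {p : ℝ → State → ℝ}

lemma continuous_div (hp : IsForwardSolution lam mu theta m p) (x : State → ℝ) (s : State) :
    Continuous fun t => (p t / x) s :=
  (hp.continuous s).div_const _

lemma div_nonneg (hp : IsForwardSolution lam mu theta m p) (h : IsStationary lam mu theta x)
    (t : ℝ) (s : State) : 0 ≤ (p t / x) s :=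
  _root_.div_nonneg (hp.nonneg t s) (h.pos s).le

lemma hasDerivAt_div (hp : IsForwardSolution lam mu theta m p) (h : IsStationary lam mu theta x)
    (hlam : 0 < lam) (htheta : 0 < theta) (s : State) {t : ℝ} (ht : 0 < t) :
    HasDerivAt (fun t => (p t / x) s) (reverseGenerator lam mu theta (p t / x) s) t := by
  refine ((hp.hasDerivAt s t ht).div_const (x s)).congr_deriv ?_
  have hmul : p t = x * (p t / x) := funext fun s => (mul_div_cancel₀ _ (h.pos s).ne').symm
  rw [hmul, h.forward_mul hlam htheta, ← hmul, Pi.mul_apply, mul_div_cancel_left₀ _ (h.pos s).ne']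

lemma continuous_energy (hp : IsForwardSolution lam mu theta m p) (x : State → ℝ) {φ : ℝ → ℝ}
    (hφ : Continuous φ) (n : ℕ) : Continuous fun t => energy x φ (p t / x) n :=
  continuous_finsetSum _ fun k _ => continuous_finsetSum _ fun c _ =>
    (hφ.comp (hp.continuous_div x (c, k))).const_mul _

lemma continuous_dissipation (hp : IsForwardSolution lam mu theta m p) (lam' mu' : ℝ)
    (x : State → ℝ) (n : ℕ) : Continuous fun t => dissipation lam' mu' x (p t / x) n :=
  continuous_finsetSum _ fun k _ =>
    ((((hp.continuous_div x (busy, k)).sub (hp.continuous_div x (idle, k))).pow 2).const_mul _).add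
      ((((hp.continuous_div x (idle, k + 1)).sub
        (hp.continuous_div x (busy, k))).pow 2).const_mul _)

lemma hasDerivAt_energy (hp : IsForwardSolution lam mu theta m p)
    (h : IsStationary lam mu theta x) (hlam : 0 < lam) (htheta : 0 < theta) {φ φ' : ℝ → ℝ}
    (hderiv : ∀ y, HasDerivAt φ (φ' y) y) (n : ℕ) {t : ℝ} (ht : 0 < t) :
    HasDerivAt (fun t => energy x φ (p t / x) n) (∑ k ∈ Finset.range (n + 1), ∑ c,
      x (c, k) * (φ' ((p t / x) (c, k)) * reverseGenerator lam mu theta (p t / x) (c, k))) t := by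
  unfold energy
  refine HasDerivAt.fun_sum fun k _ => HasDerivAt.fun_sum fun c _ => HasDerivAt.const_mul _ ?_
  exact HasDerivAt.comp t (hderiv _) (hp.hasDerivAt_div h hlam htheta (c, k) ht)

lemma energy_sub_le (hp : IsForwardSolution lam mu theta m p) (h : IsStationary lam mu theta x)
    (hlam : 0 < lam) (hmu : 0 < mu) (htheta : 0 < theta) {φ φ' : ℝ → ℝ} {κ : ℝ} (hκ : 0 ≤ κ)
    (hφ : ∀ y, 0 ≤ φ y) (hderiv : ∀ y, HasDerivAt φ (φ' y) y)
    (hconv : ∀ y z, φ' y * (z - y) ≤ φ z - φ y - κ * (z - y) ^ 2) (n : ℕ) {t : ℝ} (ht : 0 ≤ t) :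
    energy x φ (p t / x) n - energy x φ (p 0 / x) n ≤
      (∫ u in 0..t, lam * x (busy, n) * φ ((p u / x) (idle, n + 1))) -
        κ * ∫ u in 0..t, dissipation lam mu x (p u / x) n := by
  have hφc : Continuous φ := continuous_iff_continuousAt.2 fun y => (hderiv y).continuousAt
  have hflux : Continuous fun u => lam * x (busy, n) * φ ((p u / x) (idle, n + 1)) :=
    (hφc.comp (hp.continuous_div x _)).const_mul _
  have hdiss : Continuous fun u => κ * dissipation lam mu x (p u / x) n :=
    (hp.continuous_dissipation lam mu x n).const_mul κ
  have hle := intervalIntegral.sub_le_integral_of_hasDeriv_right_of_le ht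
    (hp.continuous_energy x hφc n).continuousOn
    (fun u hu => (hp.hasDerivAt_energy h hlam htheta hderiv n hu.1).hasDerivWithinAt)
    (hflux.sub hdiss).continuousOn.integrableOn_Icc
    fun u _ => h.sum_range_deriv_mul_reverseGenerator_le hlam hmu htheta hκ hφ hconv _ n
  refine hle.trans_eq ?_
  rw [← intervalIntegral.integral_const_mul]
  exact intervalIntegral.integral_sub (hflux.intervalIntegrable 0 t) (hdiss.intervalIntegrable 0 t)

lemma summable_integral_idle (hp : IsForwardSolution lam mu theta m p) {t : ℝ} (ht : 0 ≤ t) :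
    Summable fun n : ℕ => ∫ u in 0..t, p u (idle, n) := by
  refine summable_of_sum_range_le (c := ∫ _ in 0..t, m)
    (fun n => intervalIntegral.integral_nonneg ht fun u _ => hp.nonneg u _) fun N => ?_
  rw [← intervalIntegral.integral_finsetSum fun n _ => (hp.continuous _).intervalIntegrable _ _]
  refine intervalIntegral.integral_mono_on ht
    ((continuous_finsetSum _ fun n _ => hp.continuous _).intervalIntegrable _ _)
    intervalIntegrable_const fun u _ => ?_
  have hle := sum_le_hasSum ((Finset.range N).map ⟨_, Prod.mk_right_injective idle⟩)
    (fun _ _ => hp.nonneg u _) (hp.hasSum u)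
  rwa [Finset.sum_map] at hle

lemma integral_flux_softPos_le (hp : IsForwardSolution lam mu theta m p)
    (h : IsStationary lam mu theta x) (htheta : 0 < theta) {c : ℝ} (hc : 0 ≤ c) (n : ℕ) {t : ℝ}
    (ht : 0 ≤ t) :
    ∫ u in 0..t, lam * x (busy, n) * softPos c ((p u / x) (idle, n + 1)) ≤
      (n + 1 : ℕ) * (theta * ∫ u in 0..t, p u (idle, n + 1)) := by
  have hsoft : Continuous (softPos c) :=
    continuous_iff_continuousAt.2 fun y => (hasDerivAt_softPos c y).continuousAt
  have hpos := h.pos (idle, n + 1)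
  rw [← mul_assoc, ← intervalIntegral.integral_const_mul]
  refine intervalIntegral.integral_mono_on ht
    (((hsoft.comp (hp.continuous_div x _)).const_mul _).intervalIntegrable _ _)
    (((hp.continuous _).const_mul _).intervalIntegrable _ _) fun u _ => ?_
  calc lam * x (busy, n) * softPos c ((p u / x) (idle, n + 1))
      = (n + 1 : ℕ) * theta * (x (idle, n + 1) * softPos c ((p u / x) (idle, n + 1))) := by
        rw [← h.cut, Nat.cast_succ, mul_assoc _ (x _)]
    _ ≤ (n + 1 : ℕ) * theta * (x (idle, n + 1) * (p u / x) (idle, n + 1)) := by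
        gcongr
        exact softPos_le hc (hp.div_nonneg h u _)
    _ = (n + 1 : ℕ) * theta * p u (idle, n + 1) := by
        rw [Pi.div_apply, mul_div_cancel₀ _ hpos.ne']

-- The energy of `softPos c` is initially zero and is only fed by the flux from level `n + 1`, which
-- is arbitrarily small for suitable `n` since `softPos c` grows linearly.
lemma div_le (hp : IsForwardSolution lam mu theta m p) (h : IsStationary lam mu theta x)
    (hlam : 0 < lam) (hmu : 0 < mu) (htheta : 0 < theta) {c : ℝ} (hc : 0 ≤ c)
    (h0 : ∀ s, (p 0 / x) s ≤ c) {t : ℝ} (ht : 0 ≤ t) (s : State) : (p t / x) s ≤ c := by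
  by_contra! hlt
  have hpos : 0 < x s * softPos c ((p t / x) s) := mul_pos (h.pos s) (softPos_pos hlt)
  obtain ⟨N, hN, hsmall⟩ := (frequently_natCast_mul_lt_of_summable
    ((hp.summable_integral_idle ht).mul_left theta) hpos).forall_exists_of_atTop (s.2 + 1)
  obtain ⟨n, rfl⟩ := Nat.exists_eq_add_of_le' (Nat.le_of_add_left_le hN)
  have henergy := hp.energy_sub_le h hlam hmu htheta le_rfl (softPos_nonneg c)
    (hasDerivAt_softPos c) (by simpa using softPosDeriv_mul_le c) n ht
  have hinitial : energy x (softPos c) (p 0 / x) n = 0 :=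
    Finset.sum_eq_zero fun k _ => Finset.sum_eq_zero fun a _ => by
      rw [softPos_eq_zero (h0 _), mul_zero]
  have hterm := mul_le_energy (fun s => (h.pos s).le) (softPos_nonneg c) (p t / x)
    (Nat.le_of_succ_le_succ hN)
  have hflux := hp.integral_flux_softPos_le h htheta hc n ht
  rw [hinitial, zero_mul] at henergy
  linarith

lemma integral_flux_sq_le (hp : IsForwardSolution lam mu theta m p)
    (h : IsStationary lam mu theta x) (hlam : 0 < lam) {c t : ℝ}
    (hle : ∀ u ∈ Set.Icc 0 t, ∀ s, (p u / x) s ≤ c) (n : ℕ) (ht : 0 ≤ t) :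
    ∫ u in 0..t, lam * x (busy, n) * (p u / x) (idle, n + 1) ^ 2 ≤
      t * (lam * x (busy, n) * c ^ 2) := by
  have hpos := h.pos (busy, n)
  calc _ ≤ ∫ _ in 0..t, lam * x (busy, n) * c ^ 2 :=
        intervalIntegral.integral_mono_on ht
          ((((hp.continuous_div x _).pow 2).const_mul _).intervalIntegrable 0 t)
          intervalIntegrable_const fun u hu => mul_le_mul_of_nonneg_left
            (pow_le_pow_left₀ (hp.div_nonneg h u _) (hle u hu _) 2) (by positivity)
    _ = _ := by rw [intervalIntegral.integral_const, sub_zero, smul_eq_mul]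

lemma integral_dissipation_le (hp : IsForwardSolution lam mu theta m p)
    (h : IsStationary lam mu theta x) (hlam : 0 < lam) (hmu : 0 < mu) (htheta : 0 < theta) {c : ℝ}
    (hc : 0 ≤ c) (h0 : ∀ s, (p 0 / x) s ≤ c) (k : ℕ) {t : ℝ} (ht : 0 ≤ t) :
    ∫ u in 0..t, dissipation lam mu x (p u / x) k ≤ c ^ 2 := by
  have hle : ∀ n, k ≤ n → ∫ u in 0..t, dissipation lam mu x (p u / x) k ≤
      c ^ 2 + t * (lam * x (busy, n) * c ^ 2) := fun n hkn => by
    have henergy := hp.energy_sub_le h hlam hmu htheta zero_le_one sq_nonneg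
      (fun y => by simpa using hasDerivAt_pow 2 y) (fun y z => by linarith) n ht
    have hfinal : 0 ≤ energy x (· ^ 2) (p t / x) n := Finset.sum_nonneg fun k _ =>
      Finset.sum_nonneg fun a _ => mul_nonneg (h.pos _).le (sq_nonneg _)
    have hinitial := h.energy_sq_le (hp.div_nonneg h 0) h0 n
    have hflux := hp.integral_flux_sq_le h hlam
      (fun u hu => hp.div_le h hlam hmu htheta hc h0 hu.1) n ht
    have hmono := intervalIntegral.integral_mono_on (μ := volume) ht
      ((hp.continuous_dissipation lam mu x k).intervalIntegrable 0 t)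
      ((hp.continuous_dissipation lam mu x n).intervalIntegrable 0 t)
      fun u _ => h.monotone_dissipation hlam.le hmu.le (p u / x) hkn
    linarith
  have hlim : Tendsto (fun n : ℕ => c ^ 2 + t * (lam * x (busy, n) * c ^ 2)) atTop (𝓝 (c ^ 2)) := by
    have hzero : Tendsto (fun n => x (busy, n)) atTop (𝓝 0) :=
      (h.hasSum.summable.comp_injective (Prod.mk_right_injective busy)).tendsto_atTop_zero
    simpa using (((hzero.const_mul lam).mul_const (c ^ 2)).const_mul t).const_add (c ^ 2)
  exact ge_of_tendsto hlim ((eventually_ge_atTop k).mono hle)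

lemma abs_div_sub_div_le (hp : IsForwardSolution lam mu theta m p)
    (h : IsStationary lam mu theta x) (hlam : 0 < lam) (hmu : 0 < mu) (htheta : 0 < theta) {c : ℝ}
    (hc : 0 ≤ c) (h0 : ∀ s, (p 0 / x) s ≤ c) {t : ℝ} (ht : 0 ≤ t) (s s' : State) :
    |(p t / x) s - (p t / x) s'| ≤ c :=
  abs_sub_le_of_nonneg_of_le (hp.div_nonneg h t s) (hp.div_le h hlam hmu htheta hc h0 ht s)
    (hp.div_nonneg h t s') (hp.div_le h hlam hmu htheta hc h0 ht s')

lemma tendsto_div_sub_of_le_dissipation (hp : IsForwardSolution lam mu theta m p)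
    (h : IsStationary lam mu theta x) (hlam : 0 < lam) (hmu : 0 < mu) (htheta : 0 < theta) {c : ℝ}
    (hc : 0 ≤ c) (h0 : ∀ s, (p 0 / x) s ≤ c) {s s' : State} {a : ℝ} {k : ℕ} (ha : 0 < a)
    (hle : ∀ r : State → ℝ, a * (r s - r s') ^ 2 ≤ dissipation lam mu x r k) :
    Tendsto (fun t => (p t / x) s - (p t / x) s') atTop (𝓝 0) := by
  have habs : ∀ t ∈ Set.Ioi 0, ∀ s s', |(p t / x) s - (p t / x) s'| ≤ c := fun t ht =>
    hp.abs_div_sub_div_le h hlam hmu htheta hc h0 (le_of_lt ht)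
  have hderiv : ∀ t ∈ Set.Ioi 0, HasDerivAt (fun t => (p t / x) s - (p t / x) s')
      (reverseGenerator lam mu theta (p t / x) s - reverseGenerator lam mu theta (p t / x) s') t :=
    fun t ht => (hp.hasDerivAt_div h hlam htheta s ht).sub (hp.hasDerivAt_div h hlam htheta s' ht)
  have hcont : Continuous fun t => ((p t / x) s - (p t / x) s') ^ 2 :=
    ((hp.continuous_div x s).sub (hp.continuous_div x s')).pow 2
  obtain ⟨L, hL⟩ := exists_abs_reverseGenerator_le lam mu theta s
  obtain ⟨L', hL'⟩ := exists_abs_reverseGenerator_le lam mu theta s'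
  refine tendsto_zero_of_integrableOn_sq (B := c) (L := L * c + L' * c) (a := 0) ?_
    (fun t ht => (hderiv t ht).differentiableAt) (fun t ht => habs t ht s s') fun t ht => ?_
  · refine integrableOn_Ioi_of_intervalIntegral_norm_bounded (c ^ 2 / a) 0
      (fun b => hcont.integrableOn_Ioc) tendsto_id ?_
    filter_upwards [eventually_ge_atTop 0] with t ht
    simp only [Real.norm_of_nonneg (sq_nonneg _), id_eq]
    rw [le_div_iff₀' ha, ← intervalIntegral.integral_const_mul]
    exact (intervalIntegral.integral_mono_on ht ((hcont.const_mul a).intervalIntegrable _ _)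
      ((hp.continuous_dissipation lam mu x k).intervalIntegrable _ _) fun u _ => hle _).trans
        (hp.integral_dissipation_le h hlam hmu htheta hc h0 k ht)
  · rw [(hderiv t ht).deriv]
    exact (abs_sub _ _).trans (add_le_add (hL _ _ (habs t ht)) (hL' _ _ (habs t ht)))

lemma tendsto_div_sub_div_idle_zero (hp : IsForwardSolution lam mu theta m p)
    (h : IsStationary lam mu theta x) (hlam : 0 < lam) (hmu : 0 < mu) (htheta : 0 < theta) {c : ℝ}
    (hc : 0 ≤ c) (h0 : ∀ s, (p 0 / x) s ≤ c) (s : State) :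
    Tendsto (fun t => (p t / x) s - (p t / x) (idle, 0)) atTop (𝓝 0) := by
  have hservice : ∀ k, Tendsto (fun t => (p t / x) (busy, k) - (p t / x) (idle, k)) atTop (𝓝 0) :=
    fun k => hp.tendsto_div_sub_of_le_dissipation h hlam hmu htheta hc h0
      (mul_pos hmu (h.pos (busy, k))) fun r =>
        (le_add_of_nonneg_right (by have := h.pos (busy, k); positivity)).trans
          (h.term_le_dissipation hlam.le hmu.le r k)
  have horbit : ∀ k,
      Tendsto (fun t => (p t / x) (idle, k + 1) - (p t / x) (busy, k)) atTop (𝓝 0) :=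
    fun k => hp.tendsto_div_sub_of_le_dissipation h hlam hmu htheta hc h0
      (mul_pos hlam (h.pos (busy, k))) fun r =>
        (le_add_of_nonneg_left (by have := h.pos (busy, k); positivity)).trans
          (h.term_le_dissipation hlam.le hmu.le r k)
  have hidle : ∀ k, Tendsto (fun t => (p t / x) (idle, k) - (p t / x) (idle, 0)) atTop (𝓝 0) := by
    intro k
    induction k with
    | zero => simp
    | succ k ih => simpa using ((horbit k).add (hservice k)).add ih
  obtain ⟨a, k⟩ := s
  fin_cases a
  · simpa using (hservice k).add (hidle k)
  · exact hidle k

lemma tendsto_mul (hp : IsForwardSolution lam mu theta m p)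
    (h : IsStationary lam mu theta x) (hlam : 0 < lam) (hmu : 0 < mu) (htheta : 0 < theta) {c : ℝ}
    (hc : 0 ≤ c) (h0 : ∀ s, (p 0 / x) s ≤ c) (s : State) :
    Tendsto (fun t => p t s) atTop (𝓝 (m * x s)) := by
  have hcancel : ∀ t s, x s * (p t / x) s = p t s := fun t s => mul_div_cancel₀ _ (h.pos s).ne'
  have hdiff := hp.tendsto_div_sub_div_idle_zero h hlam hmu htheta hc h0
  have hsum : ∀ t, HasSum (fun s => x s * ((p t / x) s - (p t / x) (idle, 0)))
      (m - (p t / x) (idle, 0)) := fun t => by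
    simpa only [mul_sub, hcancel, one_mul] using
      (hp.hasSum t).sub (h.hasSum.mul_right ((p t / x) (idle, 0)))
  have hidle : Tendsto (fun t => m - (p t / x) (idle, 0)) atTop (𝓝 0) := by
    have hlim := tendsto_tsum_of_dominated_convergence (𝓕 := atTop) (bound := fun s => x s * c)
      (f := fun t s => x s * ((p t / x) s - (p t / x) (idle, 0)))
      (h.hasSum.summable.mul_right c) (fun s => (hdiff s).const_mul (x s)) (by
        filter_upwards [eventually_ge_atTop 0] with t ht s
        rw [norm_mul, Real.norm_of_nonneg (h.pos s).le]
        exact mul_le_mul_of_nonneg_left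
          (hp.abs_div_sub_div_le h hlam hmu htheta hc h0 ht s _) (h.pos s).le)
    simpa only [(hsum _).tsum_eq, mul_zero, tsum_zero] using hlim
  have hlim : Tendsto (fun t => (p t / x) s) atTop (𝓝 m) := by
    simpa using ((hdiff s).sub hidle).add_const m
  simpa only [hcancel, mul_comm m] using hlim.const_mul (x s)

end IsForwardSolution

section MeasureTheory

variable {Ω E : Type*} {mΩ : MeasurableSpace Ω}

lemma tendsto_natCeil_mul_div_nhdsGE (t : ℝ≥0) :
    Tendsto (fun n : ℕ => (⌈t * n⌉₊ / n : ℝ≥0)) atTop (𝓝[≥] t) := by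
  refine tendsto_nhdsWithin_iff.2 ⟨NNReal.tendsto_coe.1 ?_, ?_⟩
  · simpa using! (tendsto_nat_ceil_mul_div_atTop t.coe_nonneg).comp tendsto_natCast_atTop_atTop
  · filter_upwards [eventually_gt_atTop 0] with n hn
    have hpos : (0 : ℝ≥0) < n := Nat.cast_pos.2 hn
    exact (le_div_iff₀ hpos).2 (Nat.le_ceil _)

lemma measurable_uncurry_of_rightContinuous [TopologicalSpace E]
    [TopologicalSpace.PseudoMetrizableSpace E] [MeasurableSpace E] [BorelSpace E]
    {X : ℝ≥0 → Ω → E} (hmeas : ∀ t, Measurable (X t))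
    (hcont : ∀ ω t, ContinuousWithinAt (fun s => X s ω) (Set.Ici t) t) :
    Measurable (Function.uncurry X) := by
  have hgrid : ∀ n : ℕ, Measurable fun q : ℕ × Ω => X (q.1 / n) q.2 := fun n =>
    measurable_from_prod_countable_right fun k => hmeas (k / n)
  have happrox : ∀ n : ℕ, Measurable fun q : ℝ≥0 × Ω => X (⌈q.1 * n⌉₊ / n) q.2 := fun n =>
    (hgrid n).comp
      ((Nat.measurable_ceil.comp (measurable_fst.mul_const _)).prodMk measurable_snd)
  exact measurable_of_tendsto_metrizable happrox
    (tendsto_pi_nhds.2 fun q => (hcont q.2 q.1).tendsto.comp (tendsto_natCeil_mul_div_nhdsGE q.1))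

lemma hasSum_measureReal_fiber [Countable E] [MeasurableSpace E] [MeasurableSingletonClass E]
    (ν : Measure Ω) [IsFiniteMeasure ν] {Y : Ω → E} (hY : Measurable Y) :
    HasSum (fun s => ν.real {ω | Y ω = s}) (ν.real Set.univ) := by
  have hsum := hasSum_integral_iUnion (μ := ν) (f := fun _ => (1 : ℝ))
    (fun s => hY (measurableSet_singleton s)) (pairwise_disjoint_fiber Y)
    (integrable_const 1).integrableOn
  rw [← Set.preimage_iUnion, Set.iUnion_of_singleton] at hsum
  simpa using! hsum

end MeasureTheory

section Duality

variable {lam mu theta : ℝ}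

lemma generator_single (s s' : State) :
    generator lam mu theta (Pi.single s 1) s' = forward lam mu theta (Pi.single s' 1) s := by
  obtain ⟨a, k⟩ := s
  obtain ⟨b, j⟩ := s'
  have hcast : j = k + 1 → (j : ℝ) = k + 1 := fun h => by rw [h, Nat.cast_succ]
  have hzero : j = 0 → (j : ℝ) = 0 := fun h => by rw [h, Nat.cast_zero]
  fin_cases a <;> fin_cases b <;>
    simp only [generator, forward, Pi.single_apply, Prod.mk.injEq] <;> grind

lemma exists_forward_eq_sum (lam mu theta : ℝ) (s : State) :
    ∃ (n : ℕ) (a : Fin n → ℝ) (r : Fin n → State),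
      ∀ p, forward lam mu theta p s = ∑ i, a i * p (r i) := by
  obtain ⟨c, k⟩ := s
  fin_cases c
  · refine ⟨4, ![if k = 0 then 0 else lam, -(lam + mu), lam, (k + 1) * theta],
      ![(busy, k - 1), (busy, k), (idle, k), (idle, k + 1)], fun p => ?_⟩
    refine (forward_busy p k).trans ?_
    simp only [Fin.sum_univ_four, Matrix.cons_val, ite_mul, zero_mul]
    ring
  · refine ⟨2, ![mu, -(lam + k * theta)], ![(busy, k), (idle, k)], fun p => ?_⟩
    refine (forward_idle p k).trans ?_
    simp only [Fin.sum_univ_two, Matrix.cons_val]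
    ring

end Duality

/-- The distribution at time `t` of the process `X` under the measure `ν`, as a function on states.
It is extended to `t < 0` by its value at `0`. -/
noncomputable def stateMass {Ω : Type*} {_ : MeasurableSpace Ω} (ν : Measure Ω)
    (X : ℝ≥0 → Ω → State) (t : ℝ) (s : State) : ℝ :=
  ν.real {ω | X t.toNNReal ω = s}

section StateMass

variable {Ω : Type*} {mΩ : MeasurableSpace Ω} {lam mu theta : ℝ} {ν : Measure Ω}
  {X : ℝ≥0 → Ω → State}

lemma stateMass_eq_integral (hX : ∀ t, Measurable (X t)) (t : ℝ) (s : State) :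
    stateMass ν X t s = ∫ ω, (Pi.single (X t.toNNReal ω) 1 : State → ℝ) s ∂ν := by
  have hset : MeasurableSet {ω | X t.toNNReal ω = s} := hX _ (measurableSet_singleton s)
  rw [stateMass, ← integral_indicator_one hset]
  refine integral_congr_ae (.of_forall fun ω => ?_)
  simp [Pi.single_apply, Set.indicator_apply, eq_comm]

lemma integral_generator_single [IsFiniteMeasure ν] (hX : ∀ t, Measurable (X t)) (t : ℝ)
    (s : State) :
    ∫ ω, generator lam mu theta (Pi.single s 1) (X t.toNNReal ω) ∂ν =
      forward lam mu theta (stateMass ν X t) s := by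
  obtain ⟨n, a, r, h⟩ := exists_forward_eq_sum lam mu theta s
  have hint : ∀ s', Integrable (fun ω => (Pi.single (X t.toNNReal ω) 1 : State → ℝ) s') ν :=
    fun s' => .of_bound ((measurable_of_countable fun s => (Pi.single s 1 : State → ℝ) s').comp
      (hX _)).aestronglyMeasurable 1 (.of_forall fun ω => by
        rw [Pi.single_apply]
        split_ifs <;> simp)
  simp only [generator_single, h, stateMass_eq_integral hX, ← integral_const_mul]
  exact integral_finsetSum _ fun i _ => (hint _).const_mul _

lemma intervalIntegrable_forward_stateMass [IsFiniteMeasure ν]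
    (hX : Measurable (Function.uncurry X)) (s : State) (b c : ℝ) :
    IntervalIntegrable (fun t => forward lam mu theta (stateMass ν X t) s) volume b c := by
  obtain ⟨n, a, r, h⟩ := exists_forward_eq_sum lam mu theta s
  have hmeas : ∀ s, Measurable fun t => stateMass ν X t s := fun s =>
    (measurable_measure_prodMk_left (ν := ν) (hX.comp
      ((measurable_real_toNNReal.comp measurable_fst).prodMk measurable_snd)
        (measurableSet_singleton s))).ennreal_toReal
  have hint : ∀ s, IntervalIntegrable (fun t => stateMass ν X t s) volume b c := fun s =>
    (intervalIntegrable_const (c := ν.real Set.univ)).mono_fun (hmeas s).aestronglyMeasurable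
      (.of_forall fun t => by
        simpa [abs_of_nonneg, stateMass] using! measureReal_mono (Set.subset_univ _))
  simp only [h]
  simpa only [Finset.sum_fn] using
    IntervalIntegrable.sum Finset.univ fun i _ => (hint (r i)).const_mul (a i)

end StateMass

namespace IsRetrialQueue

variable {Ω : Type*} {mΩ : MeasurableSpace Ω} {lam mu theta : ℝ} {P : Measure Ω}
  {ℱ : Filtration ℝ≥0 mΩ} {X : ℝ≥0 → Ω → State} {A : Set Ω}

lemma measurable (hX : IsRetrialQueue lam mu theta P ℱ X) (t : ℝ≥0) : Measurable (X t) :=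
  (hX.adapted t).mono (ℱ.le t) le_rfl

lemma measurable_uncurry (hX : IsRetrialQueue lam mu theta P ℱ X) :
    Measurable (Function.uncurry X) :=
  measurable_uncurry_of_rightContinuous hX.measurable hX.rightContinuous

lemma dynkin_formula [IsFiniteMeasure P] (hX : IsRetrialQueue lam mu theta P ℱ X)
    {f : State → ℝ} (hf : (Function.support f).Finite) {C : ℝ}
    (hC : ∀ s, ‖generator lam mu theta f s‖ ≤ C) (hA : MeasurableSet[ℱ 0] A) {t : ℝ} (ht : 0 ≤ t) :
    ∫ ω in A, f (X t.toNNReal ω) ∂P = ∫ ω in A, f (X 0 ω) ∂P +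
      ∫ u in 0..t, ∫ ω in A, generator lam mu theta f (X u.toNNReal ω) ∂P := by
  have hmart := (hX.martingale f hf).setIntegral_eq (zero_le (a := t.toNNReal)) hA
  have : IsFiniteMeasure (volume.restrict (Set.uIoc 0 t)) := ⟨by simp⟩
  have hint : Integrable (Function.uncurry fun u ω => generator lam mu theta f (X u.toNNReal ω))
      ((volume.restrict (Set.uIoc 0 t)).prod (P.restrict A)) :=
    .of_bound ((measurable_of_countable (generator lam mu theta f)).comp (hX.measurable_uncurry.comp
      ((measurable_real_toNNReal.comp measurable_fst).prodMk
        measurable_snd))).aestronglyMeasurable C (.of_forall fun q => hC _)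
  have hgen : Integrable (fun ω => ∫ u in 0..t, generator lam mu theta f (X u.toNNReal ω))
      (P.restrict A) := by
    simp only [intervalIntegral.integral_of_le ht, ← Set.uIoc_of_le ht]
    exact hint.integral_prod_right
  have hsub := ((hX.martingale f hf).integrable t.toNNReal).restrict (s := A)
  simp only [NNReal.coe_zero, intervalIntegral.integral_same, sub_zero,
    Real.coe_toNNReal t ht] at hmart hsub
  rw [intervalIntegral_integral_swap hint, hmart, ← integral_add hsub hgen]
  simp only [sub_add_cancel]

lemma stateMass_eq_add_integral_forward [IsFiniteMeasure P] (hX : IsRetrialQueue lam mu theta P ℱ X)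
    (hA : MeasurableSet[ℱ 0] A) (s : State) {t : ℝ} (ht : 0 ≤ t) :
    stateMass (P.restrict A) X t s = stateMass (P.restrict A) X 0 s +
      ∫ u in 0..t, forward lam mu theta (stateMass (P.restrict A) X u) s := by
  obtain ⟨n, a, r, h⟩ := exists_forward_eq_sum lam mu theta s
  have hbound : ∀ s', ‖generator lam mu theta (Pi.single s 1) s'‖ ≤ ∑ i, ‖a i‖ := fun s' => by
    rw [generator_single, h]
    refine norm_sum_le_of_le _ fun i _ => ?_
    rw [norm_mul, Pi.single_apply]
    split_ifs <;> simp
  have hdynkin := hX.dynkin_formula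
    ((Set.finite_singleton s).subset (Pi.support_single_subset (a := (1 : ℝ)))) hbound hA ht
  simp only [integral_generator_single hX.measurable] at hdynkin
  simpa only [stateMass_eq_integral hX.measurable, Pi.single_comm, Real.toNNReal_zero] using hdynkin

lemma isForwardSolution_stateMass [IsFiniteMeasure P] (hX : IsRetrialQueue lam mu theta P ℱ X)
    (hA : MeasurableSet[ℱ 0] A) :
    IsForwardSolution lam mu theta (P.real A) (stateMass (P.restrict A) X) := by
  have hcont : ∀ s, Continuous fun t => stateMass (P.restrict A) X t s := fun s => by
    have heq : ∀ t, stateMass (P.restrict A) X 0 s +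
        ∫ u in 0..max t 0, forward lam mu theta (stateMass (P.restrict A) X u) s =
          stateMass (P.restrict A) X t s := fun t => by
      have hmax : (max t 0).toNNReal = t.toNNReal := NNReal.eq (by simp)
      rw [← hX.stateMass_eq_add_integral_forward hA s (le_max_right t 0)]
      simp only [stateMass, hmax]
    refine Continuous.congr ?_ heq
    exact continuous_const.add ((intervalIntegral.continuous_primitive
      (intervalIntegrable_forward_stateMass hX.measurable_uncurry s) 0).comp
        (continuous_id.max continuous_const))
  refine ⟨fun t s => measureReal_nonneg, fun t => ?_, hcont, fun s t ht => ?_⟩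
  · have hsum := hasSum_measureReal_fiber (P.restrict A) (hX.measurable t.toNNReal)
    rwa [measureReal_restrict_apply_univ] at hsum
  · obtain ⟨n, a, r, h⟩ := exists_forward_eq_sum lam mu theta s
    have hforward : Continuous fun u => forward lam mu theta (stateMass (P.restrict A) X u) s := by
      simp only [h]
      exact continuous_finsetSum _ fun i _ => (hcont (r i)).const_mul (a i)
    refine ((hforward.integral_hasStrictDerivAt 0 t).hasDerivAt.const_add
      (stateMass (P.restrict A) X 0 s)).congr_of_eventuallyEq ?_
    filter_upwards [eventually_gt_nhds ht] with u hu
    exact hX.stateMass_eq_add_integral_forward hA s hu.le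

lemma tendsto_stateMass [IsFiniteMeasure P] (hX : IsRetrialQueue lam mu theta P ℱ X)
    {x : State → ℝ} (h : IsStationary lam mu theta x) (hlam : 0 < lam) (hmu : 0 < mu)
    (htheta : 0 < theta) (s₀ s : State) :
    Tendsto (fun t => stateMass (P.restrict {ω | X 0 ω = s₀}) X t s) atTop
      (𝓝 (P.real {ω | X 0 ω = s₀} * x s)) := by
  have hfiber : ∀ s, MeasurableSet {ω | X 0 ω = s} := fun s =>
    hX.measurable 0 (measurableSet_singleton s)
  have hfiber₀ : MeasurableSet[ℱ 0] {ω | X 0 ω = s₀} := hX.adapted 0 (measurableSet_singleton s₀)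
  refine (hX.isForwardSolution_stateMass hfiber₀).tendsto_mul h hlam hmu htheta
    (c := P.real Set.univ / x s₀) (div_nonneg measureReal_nonneg (h.pos _).le) (fun s => ?_) s
  rw [Pi.div_apply, stateMass, Real.toNNReal_zero, measureReal_restrict_apply (hfiber s)]
  rcases eq_or_ne s s₀ with rfl | hne
  · exact div_le_div_of_nonneg_right (measureReal_mono (Set.subset_univ _)) (h.pos _).le
  · have hempty : {ω | X 0 ω = s} ∩ {ω | X 0 ω = s₀} = ∅ :=
      Set.disjoint_iff_inter_eq_empty.1 (pairwise_disjoint_fiber (X 0) hne)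
    rw [hempty, measureReal_empty, zero_div]
    exact div_nonneg measureReal_nonneg (h.pos _).le

lemma tendsto_prob [IsProbabilityMeasure P] (hX : IsRetrialQueue lam mu theta P ℱ X)
    {x : State → ℝ} (h : IsStationary lam mu theta x) (hlam : 0 < lam) (hmu : 0 < mu)
    (htheta : 0 < theta) (s : State) :
    Tendsto (fun t : ℝ≥0 => P.real {ω | X t ω = s}) atTop (𝓝 (x s)) := by
  have hinitial := hasSum_measureReal_fiber P (hX.measurable 0)
  have hfiber : ∀ t s, MeasurableSet {ω | X t ω = s} := fun t s =>
    hX.measurable t (measurableSet_singleton s)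
  have hlim : Tendsto (fun t => ∑' s₀, stateMass (P.restrict {ω | X 0 ω = s₀}) X t s) atTop
      (𝓝 (∑' s₀, P.real {ω | X 0 ω = s₀} * x s)) := by
    refine tendsto_tsum_of_dominated_convergence hinitial.summable
      (fun s₀ => hX.tendsto_stateMass h hlam hmu htheta s₀ s) (.of_forall fun t s₀ => ?_)
    rw [stateMass, Real.norm_of_nonneg measureReal_nonneg, measureReal_restrict_apply (hfiber _ s)]
    exact measureReal_mono Set.inter_subset_right
  rw [(hinitial.mul_right (x s)).tsum_eq, probReal_univ, one_mul] at hlim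
  have hcoe : Tendsto ((↑) : ℝ≥0 → ℝ) atTop atTop := NNReal.tendsto_coe_atTop.2 tendsto_id
  refine (hlim.comp hcoe).congr fun t => ?_
  have hsum := hasSum_measureReal_fiber (P.restrict {ω | X t ω = s}) (hX.measurable 0)
  rw [measureReal_restrict_apply_univ] at hsum
  rw [← hsum.tsum_eq]
  refine tsum_congr fun s₀ => ?_
  rw [stateMass, Real.toNNReal_coe, measureReal_restrict_apply (hfiber t s),
    measureReal_restrict_apply (hfiber 0 s₀), Set.inter_comm]

end IsRetrialQueue

end RetrialQueue

theorem mainTheorem7 {Ω : Type*} {mΩ : MeasurableSpace Ω} (P : Measure Ω) [IsProbabilityMeasure P]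
    (ℱ : Filtration ℝ≥0 mΩ) (X : ℝ≥0 → Ω → RetrialQueue.State)
    (lam mu theta rho : ℝ) (hlam : 0 < lam) (hmu : 0 < mu) (htheta : 0 < theta)
    (hrho : rho = lam / mu) (hstable : rho < 1)
    (hX : RetrialQueue.IsRetrialQueue lam mu theta P ℱ X) :
    ∃ x : RetrialQueue.State → ℝ,
      -- the limiting probabilities exist and form a probability vector
      (∀ s, Tendsto (fun t : ℝ≥0 => P.real {ω | X t ω = s}) atTop (𝓝 (x s))) ∧
      (∀ s, 0 ≤ x s) ∧ HasSum x 1 ∧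
      RetrialQueue.tailPair x 0 = ![rho, 1 - rho] ∧
      -- the linear system `Π Q = (-λρ, 0, 0, …)`, block column by block column
      (∀ j : ℕ, HasSum
        (fun i : ℕ => RetrialQueue.tailPair x (i + 1) ᵥ* RetrialQueue.Q lam mu theta i j)
        (if j = 0 then ![-(lam * rho), 0] else 0)) ∧
      -- the `R`-measure exists
      (∃ R : ℕ → RetrialQueue.Block, RetrialQueue.IsRMeasure lam mu theta R) ∧
      ∀ R : ℕ → RetrialQueue.Block, RetrialQueue.IsRMeasure lam mu theta R →
        (∀ k : ℕ, 1 ≤ k → IsUnit (RetrialQueue.Psi lam mu theta R k)) ∧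
        (∀ k : ℕ, 1 ≤ k →
          R k = RetrialQueue.blockC lam * (-RetrialQueue.Psi lam mu theta R (k + 1))⁻¹) ∧
        -- all the series in the definitions of `Ψ_k`, `G_{i,i-1}` and `G_i` converge
        (∀ k : ℕ, 1 ≤ k → Summable (fun l : ℕ => RetrialQueue.prodR R k (l + 1))) ∧
        -- the factorization `Q = (I - R_U) U_D (I - G_L)`
        RetrialQueue.Q lam mu theta =
          RetrialQueue.blockMul
            (RetrialQueue.blockMul (1 - RetrialQueue.factorRU R) (RetrialQueue.factorUD lam mu theta R))
            (1 - RetrialQueue.factorGL lam mu theta R) ∧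
        -- the tail probabilities
        RetrialQueue.tailPair x 1 =
          ![lam * rho, 0] ᵥ* (-(RetrialQueue.Psi lam mu theta R 1)⁻¹) ∧
        ∀ k : ℕ, 2 ≤ k →
          RetrialQueue.tailPair x k =
            ![lam * rho, 0] ᵥ*
              (-(RetrialQueue.Psi lam mu theta R 1)⁻¹ * RetrialQueue.prodR R 1 (k - 1)) := by
  subst hrho
  obtain ⟨x, h⟩ := RetrialQueue.exists_isStationary hlam hmu htheta hstable
  refine ⟨x, hX.tendsto_prob h hlam hmu htheta, fun s => (h.pos s).le, h.hasSum,
    h.tailPair_zero hmu, h.hasSum_tailPair_vecMul_Q hmu,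
    ⟨_, h.isRMeasure_tailRatio hmu htheta⟩, fun R hRM => ?_⟩
  have hR := h.eqOn_tailRatio hmu htheta hRM.1
  have hunit := fun k (hk : 1 ≤ k) => h.isUnit_Psi hlam htheta hR hk
  have hsum := fun k (hk : 1 ≤ k) => h.summable_prodR hR hk
  have heq := fun k (hk : 1 ≤ k) => hRM.1.blockC_add_mul_Psi hk
  have hfirst := h.tailPair_one_eq hlam hmu htheta hR
  refine ⟨hunit, fun k hk => RetrialQueue.eq_blockC_mul_neg_Psi_inv (hunit (k + 1) k.succ_pos)
    (heq k hk), hsum, RetrialQueue.Q_eq_blockMul hunit heq hsum, hfirst, fun k hk => ?_⟩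
  rw [← Matrix.vecMul_vecMul, ← hfirst, h.tailPair_vecMul_prodR hR le_rfl,
    Nat.add_sub_cancel' (by omega : 1 ≤ k)]
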